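/- All graphs are finite, simple and undirected. A hole is a chordless cycle of length at least four; it is even if its length is even. The diamond is $K_4$ minus an edge. A graph is (diamond, even hole)-free if it has no induced subgraph isomorphic to the diamond or to an even hole. A clique cutset of a connected graph $G$ is a clique $X\subseteq V(G)$ such that $G\setminus X$ is disconnected. The rank-width $\operatorname{rw}(G)$ is the minimum, over all pairs $(T,\lambda)$ of a cubic tree $T$ (a tree with at least two nodes in which every node that is not a leaf has degree $3$) and a bijection $\lambda$ from $V(G)$ to the leaves of $T$, of the maximum over the edges $e$ of $T$ of the rank over $\mathbb F_2$ of the submatrix $A_G[X,V(G)\setminus X]$ of the adjacency matrix, where $X$ is the set of vertices mapped to one of the two components of $T-e$; and $\operatorname{rw}(G)=0$ if $|V(G)|\le 1$. For $1\le k\le d$ let $S_k$ be the set of tuples $(a_1,\dots,a_k)$ with $a_1,\dots,a_{k-1}\in\{1,3\}$ and $a_k\in\{1,2,3,4\}$, and let $S^d=\bigcup_{k=1}^d S_k$, ordered lexicographically (a proper prefix of a tuple being smaller than the tuple). Let $P'_d$ be the path on $S^d$ that joins consecutive elements of this order, and let $P_d$ be obtained from $P'_d$ by subdividing each edge $uv$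 twice if $u$ and $v$ have the same length, and once otherwise. The graph $G_d$ is obtained from $P_d$ by adding new, pairwise adjacent vertices $v_1,\dots,v_d$, where $v_k$ is adjacent to exactly the elements of $S_k$ on $P_d$. Theorem. 1. For every $d\ge 2$, the graph $G_d$ is connected, (diamond, even hole)-free, and has no clique cutset. 2. The family $(G_d)_{d\ge 2}$ has unbounded rank-width: there is no $k$ with $\operatorname{rw}(G_d)\le k$ for all $d\ge 2$. 3. For every $d\ge 22$, $\operatorname{rw}(G_d)>\dfrac d3\ge\dfrac{\log_2|V(G_d)|-4}{3}$. 4. Consequently, connected even-hole-free graphs with no clique cutset do not have bounded rank-width. 5. Consequently, there is no constant $k$ such that every (diamond, even hole)-free graph can be decomposed by clique cutsets into induced subgraphs of clique-width at most $k$. (Here one decomposition step replaces a graph whose vertex set is a disjoint union $A\cup X\cup B$, with $A,B$ nonempty, no edges between $A$ and $B$, and $X$ a possibly empty clique, by its subgraphs induced by $A\cup X$ and $B\cup X$. Clique-width at most $k$ means that the graph is empty, or can be built with at most $k$ labels by creating labelled vertices, taking disjoint unions, relabelling all vertices of one label, and adding all edges between two different label classes.) -/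

import Mathlib

/-! ### Forbidden induced subgraphs and clique cutsets -/

/-- The diamond: the complete graph on four vertices minus one edge. -/
def diamond : SimpleGraph (Fin 4) :=
  (⊤ : SimpleGraph (Fin 4)).deleteEdges {s(0, 1)}

/-- `G` has no induced subgraph isomorphic to the diamond. -/
def DiamondFree {V : Type*} (G : SimpleGraph V) : Prop :=
  ¬ diamond.IsIndContained G

/-- `G` has no even hole, a hole being an induced cycle of length at least four. -/
def EvenHoleFree {V : Type*} (G : SimpleGraph V) : Prop :=
  ∀ n : ℕ, 4 ≤ n → Even n → ¬ (SimpleGraph.cycleGraph n).IsIndContained G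

/-- `X` is a clique cutset of `G`: `G` is connected, `X` is a clique and `G ∖ X` is
disconnected.  (`Preconnected` is used, so that the null graph is not disconnected.) -/
def IsCliqueCutset {V : Type*} (G : SimpleGraph V) (X : Set V) : Prop :=
  G.Connected ∧ G.IsClique X ∧ ¬ (G.induce Xᶜ).Preconnected

/-! ### Rank-width -/

/-- A leaf is a node incident to exactly one edge. -/
def IsLeaf {N : Type*} (T : SimpleGraph N) (x : N) : Prop :=
  (T.neighborSet x).ncard = 1

/-- A cubic tree: a tree with at least two nodes all of whose internal nodes have degree 3. -/
def IsCubicTree {N : Type*} (T : SimpleGraph N) : Prop :=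
  T.IsTree ∧ Nontrivial N ∧ ∀ x, ¬ IsLeaf T x → (T.neighborSet x).ncard = 3

open Classical in
/-- The cutrank function: the rank over the binary field of the submatrix of the adjacency
matrix with rows `X` and columns `V ∖ X`. -/
noncomputable def cutRank {V : Type*} [Fintype V] (G : SimpleGraph V) (X : Set V) : ℕ :=
  ((G.adjMatrix (ZMod 2)).submatrix
    (Subtype.val : ↥X → V) (Subtype.val : ↥(Xᶜ : Set V) → V)).rank

/-- A rank decomposition of a graph with vertex set `V`: a finite cubic tree together with a
bijection from `V` to its set of leaves. -/
structure RankDecomposition (V : Type*) where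
  Node : Type
  [fintypeNode : Fintype Node]
  tree : SimpleGraph Node
  isCubicTree : IsCubicTree tree
  toLeaf : V ≃ {x : Node // IsLeaf tree x}

attribute [instance] RankDecomposition.fintypeNode

/-- The vertices of the graph that are mapped to the component of `x` in `T - xy`. -/
def RankDecomposition.side {V : Type*} (D : RankDecomposition V) (x y : D.Node) : Set V :=
  {v | (D.tree.deleteEdges {s(x, y)}).Reachable x (D.toLeaf v).1}

open Classical in
/-- The width of a rank decomposition: the maximal cutrank over all tree edges.  Each edge is
counted in both directions, which is harmless as the cutrank function is symmetric. -/
noncomputable def RankDecomposition.width {V : Type*} [Fintype V] (D : RankDecomposition V)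
    (G : SimpleGraph V) : ℕ :=
  (Finset.univ : Finset D.tree.Dart).sup fun e => cutRank G (D.side e.fst e.snd)

/-- The rank-width: the minimal width of a rank decomposition (0 for at most one vertex). -/
noncomputable def rankWidth {V : Type*} [Fintype V] (G : SimpleGraph V) : ℕ :=
  if Fintype.card V ≤ 1 then 0
  else sInf {k : ℕ | ∃ D : RankDecomposition V, D.width G = k}

/-! ### Clique-width and decompositions by clique cutsets -/

open Classical in
/-- `CliqueWidthBuild k S lab H`: the graph with vertex set `S` and the edges of `H`, whose
vertices are labelled by `lab`, is the value of a `k`-expression, that is, it is obtained by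
creating labelled vertices, disjoint unions, relabellings `i → j`, and joins (adding all edges
between the vertices of label `i` and those of label `j`, where `i ≠ j`). The values of `lab`
outside `S` are irrelevant. -/
inductive CliqueWidthBuild {V : Type*} (k : ℕ) :
    Set V → (V → Fin k) → SimpleGraph V → Prop
  | vertex (v : V) (lab : V → Fin k) : CliqueWidthBuild k {v} lab ⊥
  | union {S₁ S₂ : Set V} {lab₁ lab₂ : V → Fin k} {H₁ H₂ : SimpleGraph V} :
      Disjoint S₁ S₂ → CliqueWidthBuild k S₁ lab₁ H₁ → CliqueWidthBuild k S₂ lab₂ H₂ →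
      CliqueWidthBuild k (S₁ ∪ S₂) (fun v => if v ∈ S₁ then lab₁ v else lab₂ v) (H₁ ⊔ H₂)
  | relabel (i j : Fin k) {S : Set V} {lab : V → Fin k} {H : SimpleGraph V} :
      CliqueWidthBuild k S lab H →
      CliqueWidthBuild k S (fun v => if lab v = i then j else lab v) H
  | join (i j : Fin k) {S : Set V} {lab : V → Fin k} {H : SimpleGraph V} :
      i ≠ j → CliqueWidthBuild k S lab H →
      CliqueWidthBuild k S lab
        (H ⊔ SimpleGraph.fromRel fun u v => u ∈ S ∧ v ∈ S ∧ lab u = i ∧ lab v = j)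

/-- `G` has clique-width at most `k` (the null graph has clique-width 0). -/
def CliqueWidthLE {V : Type*} (k : ℕ) (G : SimpleGraph V) : Prop :=
  IsEmpty V ∨ ∃ lab : V → Fin k, CliqueWidthBuild k Set.univ lab G

/-- `DecomposesInto G P S`: the induced subgraph `G[S]` can be decomposed by clique cutsets into
induced subgraphs `G[S']` with `P S'`.  In one step `G[A ∪ X ∪ B]`, where `X` is a clique (possibly
empty, to treat disconnected graphs) separating the nonempty sets `A` and `B`, is replaced by
`G[A ∪ X]` and `G[B ∪ X]`. -/
inductive DecomposesInto {V : Type*} (G : SimpleGraph V) (P : Set V → Prop) : Set V → Prop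
  | piece {S : Set V} : P S → DecomposesInto G P S
  | cut {A B X : Set V} : A.Nonempty → B.Nonempty →
      Disjoint A B → Disjoint A X → Disjoint B X → G.IsClique X →
      (∀ a ∈ A, ∀ b ∈ B, ¬ G.Adj a b) →
      DecomposesInto G P (A ∪ X) → DecomposesInto G P (B ∪ X) →
      DecomposesInto G P (A ∪ X ∪ B)

/-! ### The graphs `G_d` -/

/-- `a` is a tuple `(a₁, …, a_k)` with `1 ≤ k ≤ d`, `a₁, …, a_{k-1} ∈ {1, 3}` and
`a_k ∈ {1, 2, 3, 4}`. -/
def IsTuple (d : ℕ) (a : List ℕ) : Prop :=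
  ∃ (p : List ℕ) (x : ℕ), a = p ++ [x] ∧ p.length + 1 ≤ d ∧
    (∀ y ∈ p, y = 1 ∨ y = 3) ∧ (x = 1 ∨ x = 2 ∨ x = 3 ∨ x = 4)

/-- The set `S^d` of all such tuples.  It inherits from `List ℕ` the lexicographic linear order,
in which a proper prefix of a tuple is smaller than the tuple. -/
abbrev Tuple (d : ℕ) : Type := {a : List ℕ // IsTuple d a}

theorem tuple_finite (d : ℕ) : {a : List ℕ | IsTuple d a}.Finite := by
  refine ((List.finite_length_le (Fin 5) d).image (List.map Fin.val)).subset ?_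
  rintro a ⟨p, x, rfl, hl, hp, hx⟩
  have h : ∀ y ∈ p ++ [x], y < 5 := by
    intro y hy
    rcases List.mem_append.1 hy with h | h
    · rcases hp y h with h | h <;> omega
    · have := List.mem_singleton.1 h
      omega
  refine ⟨(p ++ [x]).pmap (fun y hy => (⟨y, hy⟩ : Fin 5)) h, ?_, ?_⟩
  · simpa using hl
  · simp [List.map_pmap]

noncomputable instance (d : ℕ) : Fintype (Tuple d) := (tuple_finite d).fintype

/-- Pairs of consecutive elements of `S^d`, i.e. the edges of the path `P'_d`. -/
abbrev Step (d : ℕ) : Type := {e : Tuple d × Tuple d // e.1 ⋖ e.2}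

noncomputable instance (d : ℕ) : Fintype (Step d) := Fintype.ofFinite _

/-- The number of subdivision vertices on an edge of `P'_d`: two if its ends have the same
length, one otherwise. -/
def subdivCount {d : ℕ} (e : Step d) : ℕ :=
  if e.1.1.1.length = e.1.2.1.length then 2 else 1

/-- The vertices of `G_d`: the centers `v_1, …, v_d` (the center `v_{i+1}` is the element `i` of
`Fin d`), the elements of `S^d`, and the subdivision vertices of each edge of `P'_d`. -/
abbrev GVert (d : ℕ) : Type := Fin d ⊕ Tuple d ⊕ (Σ e : Step d, Fin (subdivCount e))

/-- The edges of `G_d`, each listed in at least one of its two directions. -/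
inductive GEdge (d : ℕ) : GVert d → GVert d → Prop
  | centers (i j : Fin d) : i ≠ j → GEdge d (.inl i) (.inl j)
  | spoke (i : Fin d) (a : Tuple d) : a.1.length = i.1 + 1 → GEdge d (.inl i) (.inr (.inl a))
  | first (e : Step d) (m : Fin (subdivCount e)) : m.1 = 0 →
      GEdge d (.inr (.inl e.1.1)) (.inr (.inr ⟨e, m⟩))
  | middle (e : Step d) (m m' : Fin (subdivCount e)) : m'.1 = m.1 + 1 →
      GEdge d (.inr (.inr ⟨e, m⟩)) (.inr (.inr ⟨e, m'⟩))
  | last (e : Step d) (m : Fin (subdivCount e)) : m.1 + 1 = subdivCount e →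
      GEdge d (.inr (.inr ⟨e, m⟩)) (.inr (.inl e.1.2))

/-- The graph `G_d`. -/
def graphG (d : ℕ) : SimpleGraph (GVert d) := SimpleGraph.fromRel (GEdge d)

/-!
# (Diamond, even hole)-free graphs without clique cutset have unbounded rank-width

The graph `G_d` consists of a long path `P_d` and a clique of `d` centers, the `k`-th of which is
adjacent to the vertices in `S_k` of the path.

*No even holes.* A vertex of the path has at most one center as a neighbour, and two neighbours of
a center are never consecutive on the path. Hence all triangles consist of centers, which excludes
diamonds, and a hole consists of one or two (adjacent) centers and of an interval of the path
whose ends, but no other vertices, are adjacent to these centers. So everything depends on the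
parities of the distances on the path, and these are governed by the last entries of tuples:
consecutive elements of `S_k` have last entries of different parity (`lastDigit_ne_of_consecutive`),
while an element of `S_k` and one of `S_l`, `k ≠ l`, without elements of `S_k ∪ S_l` in between
have last entries of the same parity (`lastDigit_eq_of_consecutive`). Applied to consecutive
elements of `S^d`, these two facts also show that the subdivisions are chosen such that the last
entry of a tuple has the parity of its position on `P_d`, up to a constant (`lastDigit_step`,
`pos_add_pathParity`). Therefore holes with one center and holes with two centers are both odd.

*No clique cutset.* Both ends of the path are adjacent to the first center. A clique that contains
it contains at most one vertex `p` of the path. The second center has neighbours on the nonempty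
ones among the two sides of `p`, and it survives if there is such a `p`
(`exists_forall_reachableAvoiding`).

*Large width.* A word of length `j` over `{1, 3}` defines a block, an interval of the path which
contains neighbours of all centers but the first `j`. Let `X` be a set of vertices such that `X`
and its complement both contain the first vertices of at least a third of the `2 ^ j` blocks. If one
block lies in `X` and another one in the complement, then of the `d - j` last centers those on one
side, at least half of them, are matched by an induced matching to vertices of a block on the other
side. Otherwise at least `2 ^ j / 3` blocks meet both sides, and each of them contains an edge of
the path between the sides; these edges form an induced matching, too. With `d < 2 ^ j` and
`3 j < d` there is an induced matching of more than `d / 3` edges in both cases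
(`exists_set_forall_balanced_crossMatching`). An induced matching across `X` is an identity
submatrix of the cut matrix, and a cubic tree has an edge that splits a given set of leaves in such
a balanced way (`RankDecomposition.exists_balanced`), so the rank-width exceeds `d / 3`.

Likewise, a `k`-expression has a subexpression whose vertex set is balanced
(`CliqueWidthBuild.exists_balanced`); as vertices of the same label have the same neighbours
outside of it, an induced matching across this set has at most `k` edges, so that `d / 3 < k`.
Since `G_d` has no clique cutset, it cannot be decomposed into smaller pieces.
-/

/-! ### The lexicographic order on tuples -/

theorem List.append_lt_append_left_iff (p s t : List ℕ) : p ++ s < p ++ t ↔ s < t := by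
  induction p with
  | nil => simp
  | cons a p ih => simp [ih]

/-- Between words of equal length, the lexicographic comparison is not affected by suffixes. -/
theorem List.append_lt_append_of_length_eq {p q : List ℕ} (s t : List ℕ)
    (hl : p.length = q.length) (h : p < q) : p ++ s < q ++ t := by
  induction p generalizing q with
  | nil =>
    cases q with
    | nil => simp at h
    | cons b q => simp at hl
  | cons a p ih =>
    cases q with
    | nil => simp at hl
    | cons b q =>
      simp only [List.cons_append, List.cons_lt_cons_iff] at h ⊢
      rcases h with h | ⟨h, h'⟩
      · exact .inl h
      · exact .inr ⟨h, ih (by simpa using hl) h'⟩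

theorem List.lt_append_of_ne_nil (p : List ℕ) {t : List ℕ} (ht : t ≠ []) : p < p ++ t := by
  obtain ⟨a, t, rfl⟩ := List.exists_cons_of_ne_nil ht
  simpa using (List.append_lt_append_left_iff p [] (a :: t)).2 (List.nil_lt_cons a t)

theorem List.append_singleton_lt_iff {p : List ℕ} {x y : ℕ} : p ++ [x] < p ++ [y] ↔ x < y := by
  rw [List.append_lt_append_left_iff, List.cons_lt_cons_iff]
  simp

theorem List.append_singleton_lt_of_length_eq {p q : List ℕ} {x y : ℕ}
    (hl : p.length = q.length) (h : p ++ [x] < q ++ [y]) : p < q ∨ p = q ∧ x < y := by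
  rcases lt_trichotomy p q with hpq | hpq | hpq
  · exact .inl hpq
  · subst hpq
    exact .inr ⟨rfl, List.append_singleton_lt_iff.1 h⟩
  · exact absurd h (List.append_lt_append_of_length_eq [y] [x] hl.symm hpq).asymm

/-- Among words over `{1, 3}` of a given length, `1 ⋯ 1` is the smallest. -/
theorem List.replicate_one_append_le {t : List ℕ} (x : ℕ) (ht : ∀ y ∈ t, y = 1 ∨ y = 3)
    (hx : 1 ≤ x) : List.replicate t.length 1 ++ [1] ≤ t ++ [x] := by
  induction t with
  | nil => exact not_lt.1 fun h => hx.not_gt ((List.append_singleton_lt_iff (p := [])).1 h)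
  | cons a t ih =>
    simp only [List.length_cons, List.replicate_succ, List.cons_append]
    have ih := ih fun y hy => ht y (by simp [hy])
    rcases ht a (by simp) with rfl | rfl
    · exact List.cons_le_cons 1 ih
    · exact le_of_lt (List.cons_lt_cons_iff.2 (.inl (by norm_num)))

/-- Among words over `{1, 3}` of a given length followed by a letter at most `4`, the word
`3 ⋯ 3 4` is the largest. -/
theorem List.le_replicate_three_append {t : List ℕ} (x : ℕ) (ht : ∀ y ∈ t, y = 1 ∨ y = 3)
    (hx : x ≤ 4) : t ++ [x] ≤ List.replicate t.length 3 ++ [4] := by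
  induction t with
  | nil => exact not_lt.1 fun h => hx.not_gt ((List.append_singleton_lt_iff (p := [])).1 h)
  | cons a t ih =>
    simp only [List.length_cons, List.replicate_succ, List.cons_append]
    have ih := ih fun y hy => ht y (by simp [hy])
    rcases ht a (by simp) with rfl | rfl
    · exact le_of_lt (List.cons_lt_cons_iff.2 (.inl (by norm_num)))
    · exact List.cons_le_cons 3 ih

/-- The last entry of a tuple. -/
def lastDigit {d : ℕ} (a : Tuple d) : ℕ := a.1.getLastD 0

theorem IsTuple.mk {d : ℕ} {p : List ℕ} {x : ℕ} (hl : p.length + 1 ≤ d)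
    (hp : ∀ y ∈ p, y = 1 ∨ y = 3) (h1 : 1 ≤ x) (h4 : x ≤ 4) : IsTuple d (p ++ [x]) :=
  ⟨p, x, rfl, hl, hp, by omega⟩

theorem Tuple.exists_eq {d : ℕ} (a : Tuple d) : ∃ (p : List ℕ) (x : ℕ) (h : IsTuple d (p ++ [x])),
    a = ⟨p ++ [x], h⟩ ∧ p.length + 1 ≤ d ∧ (∀ y ∈ p, y = 1 ∨ y = 3) ∧ 1 ≤ x ∧ x ≤ 4 := by
  obtain ⟨a, p, x, rfl, hl, hp, hx⟩ := a
  exact ⟨p, x, ⟨p, x, rfl, hl, hp, hx⟩, rfl, hl, hp, by omega, by omega⟩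

/-- Two consecutive elements of `S_k` have last entries of different parity. -/
theorem lastDigit_ne_of_consecutive {d k : ℕ} {a b : Tuple d} (hab : a < b)
    (ha : a.1.length = k) (hb : b.1.length = k)
    (hc : ∀ c : Tuple d, a < c → c < b → c.1.length ≠ k) :
    lastDigit a % 2 ≠ lastDigit b % 2 := by
  obtain ⟨p, x, hpx, rfl, hpl, hp, hx1, hx4⟩ := a.exists_eq
  obtain ⟨q, y, hqy, rfl, hql, hq, hy1, hy4⟩ := b.exists_eq
  simp only [List.length_append, List.length_singleton] at ha hb
  simp only [lastDigit, List.getLastD_concat]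
  intro hpar
  have hlen : p.length = q.length := by omega
  rcases List.append_singleton_lt_of_length_eq hlen hab with hpq | ⟨rfl, hxy⟩
  · by_cases hy : 1 < y
    · refine hc ⟨q ++ [1], .mk hql hq le_rfl (by norm_num)⟩ ?_ ?_ (by simpa using hb)
      · exact List.append_lt_append_of_length_eq _ _ hlen hpq
      · exact List.append_singleton_lt_iff.2 hy
    · refine hc ⟨p ++ [4], .mk hpl hp (by norm_num) le_rfl⟩ ?_ ?_ (by simpa using ha)
      · exact List.append_singleton_lt_iff.2 (by omega)
      · exact List.append_lt_append_of_length_eq _ _ hlen hpq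
  · refine hc ⟨p ++ [x + 1], .mk hpl hp (by omega) (by omega)⟩ ?_ ?_ (by simpa using ha)
    · exact List.append_singleton_lt_iff.2 (by omega)
    · exact List.append_singleton_lt_iff.2 (by omega)

/-- If `a ∈ S_k` and `b ∈ S_l` with `k < l` have no element of `S_k ∪ S_l` in between,
then `b` is the extension `(a, 1, …, 1)` of `a`. -/
theorem lastDigit_odd_of_descent {d k l : ℕ} {a b : Tuple d} (hab : a < b) (hkl : k < l)
    (ha : a.1.length = k) (hb : b.1.length = l)
    (hc : ∀ c : Tuple d, a < c → c < b → c.1.length ≠ k ∧ c.1.length ≠ l) :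
    lastDigit a % 2 = 1 ∧ lastDigit b % 2 = 1 := by
  obtain ⟨p, x, hpx, rfl, hpl, hp, hx1, hx4⟩ := a.exists_eq
  obtain ⟨r, y, hry, rfl, hrl, hr, hy1, hy4⟩ := b.exists_eq
  simp only [List.length_append, List.length_singleton] at ha hb
  simp only [lastDigit, List.getLastD_concat]
  -- write `b = q ++ [z] ++ t ++ [y]`, where the prefix `q ++ [z]` has length `k`
  obtain ⟨q, z, t, rfl, hqp⟩ : ∃ q z t, r = q ++ [z] ++ t ∧ p.length = q.length := by
    refine ⟨r.take p.length, r[p.length]'(by omega), r.drop (p.length + 1), ?_, ?_⟩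
    · simp
    · simp; omega
  have hz := hr z (by simp)
  have hq : ∀ y ∈ q, y = 1 ∨ y = 3 := fun y hy => hr y (by simp [hy])
  have ht : ∀ y ∈ t, y = 1 ∨ y = 3 := fun y hy => hr y (by simp [hy])
  simp only [List.length_append, List.length_singleton] at hb hrl
  have hqz : IsTuple d (q ++ [z]) := .mk (by omega) hq (by omega) (by omega)
  have heq : p ++ [x] = q ++ [z] := by
    rcases lt_trichotomy (p ++ [x]) (q ++ [z]) with h | h | h
    · refine absurd ?_ (hc ⟨q ++ [z], hqz⟩ h ?_).1
      · simp; omega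
      · show q ++ [z] < q ++ [z] ++ t ++ [y]
        rw [List.append_assoc (q ++ [z])]
        exact List.lt_append_of_ne_nil _ (by simp)
    · exact h
    · refine absurd hab (lt_asymm ?_)
      have := List.append_lt_append_of_length_eq (t ++ [y]) [] (by simp [hqp]) h
      show q ++ [z] ++ t ++ [y] < p ++ [x]
      simpa using this
  obtain ⟨rfl, hxz⟩ := List.append_inj heq hqp
  obtain rfl : x = z := by simpa using hxz
  refine ⟨by omega, ?_⟩
  have hmin := List.replicate_one_append_le y ht hy1
  rcases hmin.lt_or_eq with h | h
  · exfalso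
    have hone : ∀ w ∈ p ++ [x] ++ List.replicate t.length 1, w = 1 ∨ w = 3 := by
      intro w hw
      rw [List.mem_append, List.mem_append, List.mem_singleton, List.mem_replicate] at hw
      rcases hw with (hw | rfl) | hw
      · exact hp w hw
      · exact hz
      · exact .inl hw.2
    refine (hc ⟨p ++ [x] ++ List.replicate t.length 1 ++ [1],
      .mk (by simp; omega) hone le_rfl (by norm_num)⟩ ?_ ?_).2 (by simp; omega)
    · show p ++ [x] < p ++ [x] ++ _ ++ _
      rw [List.append_assoc (p ++ [x])]
      exact List.lt_append_of_ne_nil _ (by simp)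
    · show p ++ [x] ++ _ ++ _ < p ++ [x] ++ t ++ [y]
      rw [List.append_assoc (p ++ [x]), List.append_assoc (p ++ [x])]
      exact (List.append_lt_append_left_iff _ _ _).2 h
  · have := congrArg (fun l => l.getLastD 0) h
    simp only [List.getLastD_concat] at this
    omega

/-- If `a ∈ S_k` and `b ∈ S_l` with `l < k` have no element of `S_k ∪ S_l` in between,
then `a = (q, z, 3, …, 3, 4)` and `b = (q, z + 1)` for some `q` and some `z ∈ {1, 3}`. -/
theorem lastDigit_even_of_ascent {d k l : ℕ} {a b : Tuple d} (hab : a < b) (hkl : l < k)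
    (ha : a.1.length = k) (hb : b.1.length = l)
    (hc : ∀ c : Tuple d, a < c → c < b → c.1.length ≠ k ∧ c.1.length ≠ l) :
    lastDigit a % 2 = 0 ∧ lastDigit b % 2 = 0 := by
  obtain ⟨r, x, hrx, rfl, hrl, hr, hx1, hx4⟩ := a.exists_eq
  obtain ⟨p, y, hpy, rfl, hpl, hp, hy1, hy4⟩ := b.exists_eq
  simp only [List.length_append, List.length_singleton] at ha hb
  simp only [lastDigit, List.getLastD_concat]
  obtain ⟨q, z, t, rfl, hqp⟩ : ∃ q z t, r = q ++ [z] ++ t ∧ p.length = q.length := by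
    refine ⟨r.take p.length, r[p.length]'(by omega), r.drop (p.length + 1), ?_, ?_⟩
    · simp
    · simp; omega
  have hz := hr z (by simp)
  have hq : ∀ y ∈ q, y = 1 ∨ y = 3 := fun y hy => hr y (by simp [hy])
  have ht : ∀ y ∈ t, y = 1 ∨ y = 3 := fun y hy => hr y (by simp [hy])
  simp only [List.length_append, List.length_singleton] at ha hrl
  have hqz : IsTuple d (q ++ [z + 1]) := .mk (by omega) hq (by omega) (by omega)
  have hlt : ∀ s, q ++ [z] ++ s < q ++ [z + 1] := fun s => by
    simpa using List.append_lt_append_of_length_eq s [] (by simp)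
      (List.append_singleton_lt_iff (p := q).2 (Nat.lt_succ_self z))
  have heq : p ++ [y] = q ++ [z + 1] := by
    rcases lt_trichotomy (p ++ [y]) (q ++ [z + 1]) with h | h | h
    · exfalso
      -- then `b` would be at most the prefix `q ++ [z]` of `a`
      have hle : p ++ [y] ≤ q ++ [z] := by
        rcases List.append_singleton_lt_of_length_eq hqp h with h' | ⟨rfl, h'⟩
        · exact (List.append_lt_append_of_length_eq _ _ hqp h').le
        · rcases (Nat.lt_succ_iff.1 h').lt_or_eq with h' | rfl
          · exact (List.append_singleton_lt_iff.2 h').le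
          · exact le_rfl
      have hpre : q ++ [z] < q ++ [z] ++ t ++ [x] := by
        rw [List.append_assoc (q ++ [z])]
        exact List.lt_append_of_ne_nil _ (by simp)
      exact lt_irrefl _ ((hle.trans_lt hpre).trans hab)
    · exact h
    · refine absurd ?_ (hc ⟨q ++ [z + 1], hqz⟩ ?_ h).2
      · simp; omega
      · show q ++ [z] ++ t ++ [x] < _
        rw [List.append_assoc (q ++ [z])]
        exact hlt _
  obtain ⟨rfl, hxz⟩ := List.append_inj heq hqp
  obtain rfl : y = z + 1 := by simpa using hxz
  refine ⟨?_, by omega⟩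
  have hmax := List.le_replicate_three_append x ht hx4
  rcases hmax.lt_or_eq with h | h
  · exfalso
    have hthree : ∀ w ∈ p ++ [z] ++ List.replicate t.length 3, w = 1 ∨ w = 3 := by
      intro w hw
      rw [List.mem_append, List.mem_append, List.mem_singleton, List.mem_replicate] at hw
      rcases hw with (hw | rfl) | hw
      · exact hp w hw
      · exact hz
      · exact .inr hw.2
    refine (hc ⟨p ++ [z] ++ List.replicate t.length 3 ++ [4],
      .mk (by simp; omega) hthree (by norm_num) le_rfl⟩ ?_ ?_).1 (by simp; omega)
    · show p ++ [z] ++ t ++ [x] < p ++ [z] ++ _ ++ _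
      rw [List.append_assoc (p ++ [z]), List.append_assoc (p ++ [z])]
      exact (List.append_lt_append_left_iff _ _ _).2 h
    · show p ++ [z] ++ _ ++ _ < _
      rw [List.append_assoc (p ++ [z])]
      exact hlt _
  · have := congrArg (fun l => l.getLastD 0) h
    simp only [List.getLastD_concat] at this
    omega

/-- If `a ∈ S_k` and `b ∈ S_l` with `k ≠ l` have no element of `S_k ∪ S_l` in between, then
their last entries have the same parity. -/
theorem lastDigit_eq_of_consecutive {d k l : ℕ} {a b : Tuple d} (hab : a < b) (hkl : k ≠ l)
    (ha : a.1.length = k) (hb : b.1.length = l)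
    (hc : ∀ c : Tuple d, a < c → c < b → c.1.length ≠ k ∧ c.1.length ≠ l) :
    lastDigit a % 2 = lastDigit b % 2 := by
  rcases hkl.lt_or_gt with h | h
  · obtain ⟨h1, h2⟩ := lastDigit_odd_of_descent hab h ha hb hc
    rw [h1, h2]
  · obtain ⟨h1, h2⟩ := lastDigit_even_of_ascent hab h ha hb hc
    rw [h1, h2]

/-- Along an edge of `P'_d`, the parity of the last entry changes exactly if the edge is to be
subdivided twice, so that it changes by the length of the subdivided edge. -/
theorem lastDigit_step {d : ℕ} (e : Step d) :
    lastDigit e.1.2 % 2 = (lastDigit e.1.1 + subdivCount e + 1) % 2 := by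
  have hc : ∀ c : Tuple d, e.1.1 < c → c < e.1.2 → False := fun c h h' => e.2.2 h h'
  unfold subdivCount
  split_ifs with h
  · have := lastDigit_ne_of_consecutive e.2.1 h rfl fun c h h' => (hc c h h').elim
    omega
  · have := lastDigit_eq_of_consecutive e.2.1 h rfl rfl fun c h h' => (hc c h h').elim
    omega

/-! ### Positions on the path `P_d` -/

/-- The vertices of the path `P_d`. -/
abbrev PathVert (d : ℕ) : Type := Tuple d ⊕ (Σ e : Step d, Fin (subdivCount e))

/-- The place of a vertex of `P_d`: the last tuple at or before the vertex, followed by the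
distance from that tuple. -/
def pathKey {d : ℕ} : PathVert d → Tuple d ×ₗ ℕ
  | .inl a => toLex (a, 0)
  | .inr ⟨e, m⟩ => toLex (e.1.1, m.1 + 1)

/-- The number of vertices of `P_d` that come before a given one. -/
noncomputable def pos {d : ℕ} (x : PathVert d) : ℕ := {y : PathVert d | pathKey y < pathKey x}.ncard

theorem Step.ext_left {d : ℕ} {e e' : Step d} (h : e.1.1 = e'.1.1) : e = e' := by
  obtain ⟨⟨a, b⟩, hab⟩ := e
  obtain ⟨⟨a', b'⟩, hab'⟩ := e'
  obtain rfl : a = a' := h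
  obtain rfl : b = b' := hab.unique_right hab'
  rfl

theorem pathKey_injective {d : ℕ} : Function.Injective (pathKey (d := d)) := by
  rintro (a | ⟨e, m⟩) (b | ⟨e', m'⟩) h
  · have h := congrArg ofLex h
    simp only [pathKey, ofLex_toLex, Prod.mk.injEq, and_true] at h
    rw [h]
  · have h := congrArg (fun z => (ofLex z).2) h
    simp [pathKey] at h
  · have h := congrArg (fun z => (ofLex z).2) h
    simp [pathKey] at h
  · have h := congrArg ofLex h
    simp only [pathKey, ofLex_toLex, Prod.mk.injEq, add_left_inj] at h
    obtain rfl := Step.ext_left h.1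
    rw [Fin.ext h.2]

theorem pos_lt_pos_iff {d : ℕ} {x y : PathVert d} : pos x < pos y ↔ pathKey x < pathKey y := by
  have key : ∀ {x y : PathVert d}, pathKey x < pathKey y → pos x < pos y := fun {x y} h =>
    Set.ncard_lt_ncard ⟨fun z hz => lt_trans hz h, fun hs => lt_irrefl (pathKey x) (hs h)⟩
      (Set.toFinite _)
  refine ⟨fun h => ?_, key⟩
  rcases lt_trichotomy (pathKey x) (pathKey y) with h' | h' | h'
  · exact h'
  · rw [pathKey_injective h'] at h
    exact absurd h (lt_irrefl _)
  · exact absurd h (key h').asymm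

theorem pos_injective {d : ℕ} : Function.Injective (pos (d := d)) := fun x y h => by
  rcases lt_trichotomy (pathKey x) (pathKey y) with h' | h' | h'
  · exact absurd h (pos_lt_pos_iff.2 h').ne
  · exact pathKey_injective h'
  · exact absurd h (pos_lt_pos_iff.2 h').ne'

theorem pos_inl_lt_iff {d : ℕ} {a b : Tuple d} :
    pos (.inl a : PathVert d) < pos (.inl b : PathVert d) ↔ a < b := by
  simp [pos_lt_pos_iff, pathKey, Prod.Lex.toLex_lt_toLex]

theorem pos_inl_le_iff {d : ℕ} {a b : Tuple d} :
    pos (.inl a : PathVert d) ≤ pos (.inl b : PathVert d) ↔ a ≤ b := by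
  rw [← not_lt, pos_inl_lt_iff, not_lt]

/-- No vertex of `P_d` lies between the ends of an edge of `P_d`. -/
theorem GEdge.not_pathKey_between {d : ℕ} {x y : PathVert d} (h : GEdge d (.inr x) (.inr y)) :
    pathKey x < pathKey y ∧ ∀ z : PathVert d, pathKey x < pathKey z → ¬ pathKey z < pathKey y := by
  cases h with
  | first e m hm =>
    refine ⟨by simp [pathKey, Prod.Lex.toLex_lt_toLex], ?_⟩
    rintro (a | ⟨e', m'⟩) <;>
    · simp only [pathKey, hm, Prod.Lex.toLex_lt_toLex]
      rintro (h | ⟨h, h1⟩) (h' | ⟨h', h1'⟩)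
      · exact h.asymm h'
      · exact absurd h' h.ne'
      · exact absurd h h'.ne'
      · omega
  | middle e m m' hm =>
    refine ⟨by simp [pathKey, Prod.Lex.toLex_lt_toLex, hm], ?_⟩
    rintro (a | ⟨e', m'⟩) <;>
    · simp only [pathKey, hm, Prod.Lex.toLex_lt_toLex]
      rintro (h | ⟨h, h1⟩) (h' | ⟨h', h1'⟩)
      · exact h.asymm h'
      · exact absurd h' h.ne'
      · exact absurd h h'.ne'
      · omega
  | last e m hm =>
    refine ⟨by simp [pathKey, Prod.Lex.toLex_lt_toLex, e.2.1], ?_⟩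
    rintro (a | ⟨e', m'⟩)
    · simp only [pathKey, Prod.Lex.toLex_lt_toLex]
      rintro (h | ⟨h, h1⟩) (h' | ⟨h', h1'⟩)
      · exact e.2.2 h h'
      · omega
      · omega
      · omega
    · simp only [pathKey, Prod.Lex.toLex_lt_toLex]
      rintro (h | ⟨h, h1⟩) (h' | ⟨h', h1'⟩)
      · exact e.2.2 h h'
      · omega
      · obtain rfl := Step.ext_left h
        have := m'.2
        omega
      · omega

theorem GEdge.pos_eq {d : ℕ} {x y : PathVert d} (h : GEdge d (.inr x) (.inr y)) :
    pos y = pos x + 1 := by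
  obtain ⟨hlt, hbet⟩ := h.not_pathKey_between
  have : {z : PathVert d | pathKey z < pathKey y} = insert x {z | pathKey z < pathKey x} := by
    ext z
    simp only [Set.mem_ofPred_eq, Set.mem_insert_iff]
    constructor
    · intro hz
      rcases lt_trichotomy (pathKey z) (pathKey x) with h | h | h
      · exact .inr h
      · exact .inl (pathKey_injective h)
      · exact absurd hz (hbet z h)
    · rintro (rfl | hz)
      · exact hlt
      · exact hz.trans hlt
  rw [pos, this, Set.ncard_insert_of_notMem (by simp) (Set.toFinite _), pos]

theorem subdivCount_pos {d : ℕ} (e : Step d) : 0 < subdivCount e := by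
  unfold subdivCount
  split_ifs <;> norm_num

theorem exists_GEdge_of_pos_lt {d : ℕ} {x y : PathVert d} (h : pos x < pos y) :
    ∃ z, GEdge d (.inr x) (.inr z) := by
  rcases x with a | ⟨e, m⟩
  · obtain ⟨b, hab⟩ : ∃ b : Tuple d, a < b := by
      rw [pos_lt_pos_iff] at h
      rcases y with b | ⟨e, m⟩
      · simp only [pathKey, Prod.Lex.toLex_lt_toLex] at h
        exact ⟨b, by simpa using h⟩
      · simp only [pathKey, Prod.Lex.toLex_lt_toLex] at h
        rcases h with h | ⟨h, -⟩
        · exact ⟨_, h⟩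
        · exact ⟨_, h ▸ e.2.1⟩
    obtain ⟨c, hc, -⟩ := exists_covBy_le_of_lt hab
    let e : Step d := ⟨(a, c), hc⟩
    exact ⟨_, .first e ⟨0, subdivCount_pos e⟩ rfl⟩
  · by_cases hm : m.1 + 1 = subdivCount e
    · exact ⟨_, .last e m hm⟩
    · exact ⟨_, .middle e m ⟨m.1 + 1, by omega⟩ rfl⟩

theorem GEdge_inr_inr_iff {d : ℕ} {x y : PathVert d} :
    GEdge d (.inr x) (.inr y) ↔ pos y = pos x + 1 := by
  refine ⟨GEdge.pos_eq, fun h => ?_⟩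
  obtain ⟨z, hz⟩ := exists_GEdge_of_pos_lt (x := x) (y := y) (by omega)
  rwa [pos_injective (hz.pos_eq.trans h.symm)] at hz

theorem exists_pos_eq {d : ℕ} {x y : PathVert d} {n : ℕ} (hx : pos x ≤ n) (hy : n ≤ pos y) :
    ∃ z : PathVert d, pos z = n := by
  induction n, hx using Nat.le_induction with
  | base => exact ⟨x, rfl⟩
  | succ n hn ih =>
    obtain ⟨z, hz⟩ := ih (by omega)
    obtain ⟨w, hw⟩ := exists_GEdge_of_pos_lt (x := z) (y := y) (by omega)
    exact ⟨w, by rw [hw.pos_eq, hz]⟩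

/-- Tuples are not adjacent on `P_d`, as every edge of `P'_d` is subdivided. -/
theorem pos_add_two_le {d : ℕ} {a b : Tuple d} (h : a < b) :
    pos (.inl a : PathVert d) + 2 ≤ pos (.inl b : PathVert d) := by
  have h1 := pos_inl_lt_iff.2 h
  have h2 : pos (.inl b : PathVert d) ≠ pos (.inl a : PathVert d) + 1 := fun h2 => by
    cases GEdge_inr_inr_iff.2 h2
  omega

/-- Up to an additive constant, the parity of the position on `P_d`, which is computed from the
last entry of a tuple. -/
def pathParity {d : ℕ} : PathVert d → ℕ
  | .inl a => lastDigit a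
  | .inr ⟨e, m⟩ => lastDigit e.1.1 + m.1 + 1

theorem GEdge.pathParity_eq {d : ℕ} {x y : PathVert d} (h : GEdge d (.inr x) (.inr y)) :
    pathParity y % 2 = (pathParity x + 1) % 2 := by
  cases h with
  | first e m hm => simp [pathParity, hm]
  | middle e m m' hm => simp only [pathParity, hm]; omega
  | last e m hm =>
    simp only [pathParity]
    rw [lastDigit_step e]
    omega

theorem pos_add_pathParity {d : ℕ} {x y : PathVert d} (h : pos x ≤ pos y) :
    (pos y + pathParity x) % 2 = (pos x + pathParity y) % 2 := by
  obtain ⟨n, hn⟩ := Nat.exists_eq_add_of_le h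
  induction n generalizing y with
  | zero =>
    rw [pos_injective (show pos y = pos x by omega)]
  | succ n ih =>
    obtain ⟨z, hz⟩ := exists_pos_eq (x := x) (y := y) (n := pos x + n) (by omega) (by omega)
    have h1 := ih (y := z) (by omega) hz
    have h2 := (GEdge_inr_inr_iff (x := z) (y := y)).2 (by omega)
    have h3 := h2.pathParity_eq
    omega

/-! ### Adjacency in `G_d` -/

theorem graphG_adj_inl_inl {d : ℕ} {i j : Fin d} :
    (graphG d).Adj (.inl i) (.inl j) ↔ i ≠ j := by
  simp only [graphG, SimpleGraph.fromRel_adj]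
  constructor
  · rintro ⟨h, -⟩ rfl
    exact h rfl
  · exact fun h => ⟨by simpa using h, .inl (.centers i j h)⟩

/-- The vertex `x` of `P_d` belongs to `S_{i+1}`, i.e. it is adjacent to the center `v_{i+1}`, which
is the element `i` of `Fin d`. -/
def HasLevel {d : ℕ} (i : ℕ) (x : PathVert d) : Prop :=
  ∃ a : Tuple d, x = .inl a ∧ a.1.length = i + 1

theorem HasLevel.unique {d i j : ℕ} {x : PathVert d} (h : HasLevel i x) (h' : HasLevel j x) :
    i = j := by
  obtain ⟨a, rfl, ha⟩ := h
  obtain ⟨b, hb, hb'⟩ := h'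
  cases hb
  omega

theorem graphG_adj_inl_inr {d : ℕ} {i : Fin d} {x : PathVert d} :
    (graphG d).Adj (.inl i) (.inr x) ↔ HasLevel i.1 x := by
  simp only [graphG, SimpleGraph.fromRel_adj]
  constructor
  · rintro ⟨-, h | h⟩
    · cases h with
      | spoke _ a h => exact ⟨a, rfl, h⟩
    · cases h
  · rintro ⟨a, rfl, h⟩
    exact ⟨by simp, .inl (.spoke i a h)⟩

theorem graphG_adj_inr_inr {d : ℕ} {x y : PathVert d} :
    (graphG d).Adj (.inr x) (.inr y) ↔ pos y = pos x + 1 ∨ pos x = pos y + 1 := by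
  simp only [graphG, SimpleGraph.fromRel_adj, GEdge_inr_inr_iff]
  constructor
  · exact fun h => h.2
  · refine fun h => ⟨?_, h⟩
    rintro h'
    cases h'
    omega

/-- Two neighbours on `P_d` of a center with no further neighbour in between are at odd
distance. -/
theorem odd_dist_of_same_level {d i : ℕ} {x y : PathVert d} (hxy : pos x < pos y)
    (hx : HasLevel i x) (hy : HasLevel i y)
    (hz : ∀ z : PathVert d, pos x < pos z → pos z < pos y → ¬ HasLevel i z) :
    (pos y - pos x) % 2 = 1 := by
  obtain ⟨a, rfl, ha⟩ := hx
  obtain ⟨b, rfl, hb⟩ := hy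
  have h1 := lastDigit_ne_of_consecutive (pos_inl_lt_iff.1 hxy) ha hb fun c h h' hc =>
    hz (.inl c) (pos_inl_lt_iff.2 h) (pos_inl_lt_iff.2 h') ⟨c, rfl, hc⟩
  have h2 := pos_add_pathParity hxy.le
  simp only [pathParity] at h2
  omega

/-- Neighbours on `P_d` of two different centers with no further neighbour of these centers in
between are at even distance. -/
theorem even_dist_of_ne_level {d i j : ℕ} {x y : PathVert d} (hxy : pos x < pos y) (hij : i ≠ j)
    (hx : HasLevel i x) (hy : HasLevel j y)
    (hz : ∀ z : PathVert d, pos x < pos z → pos z < pos y → ¬ HasLevel i z ∧ ¬ HasLevel j z) :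
    (pos y - pos x) % 2 = 0 := by
  obtain ⟨a, rfl, ha⟩ := hx
  obtain ⟨b, rfl, hb⟩ := hy
  have h1 := lastDigit_eq_of_consecutive (k := i + 1) (l := j + 1) (pos_inl_lt_iff.1 hxy)
    (by omega) ha hb fun c h h' =>
      (hz (.inl c) (pos_inl_lt_iff.2 h) (pos_inl_lt_iff.2 h')).imp
        (fun hn hc => hn ⟨c, rfl, hc⟩) (fun hn hc => hn ⟨c, rfl, hc⟩)
  have h2 := pos_add_pathParity hxy.le
  simp only [pathParity] at h2
  omega

/-! ### Diamonds and even holes -/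

/-- Every triangle of `G_d` consists of centers. -/
theorem not_triangle_inr {d : ℕ} {x : PathVert d} {u v : GVert d} (hu : (graphG d).Adj (.inr x) u)
    (hv : (graphG d).Adj (.inr x) v) (huv : (graphG d).Adj u v) : False := by
  -- a center is not adjacent to two consecutive vertices of the path
  have key : ∀ {i : Fin d} {y z : PathVert d}, (graphG d).Adj (.inl i) (.inr y) →
      (graphG d).Adj (.inl i) (.inr z) → (graphG d).Adj (.inr y) (.inr z) → False := by
    intro i y z hy hz hyz
    obtain ⟨a, rfl, -⟩ := graphG_adj_inl_inr.1 hy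
    obtain ⟨b, rfl, -⟩ := graphG_adj_inl_inr.1 hz
    rcases graphG_adj_inr_inr.1 hyz with h | h
    · have := pos_add_two_le (pos_inl_lt_iff.1
        (by omega : pos (.inl a : PathVert d) < pos (.inl b)))
      omega
    · have := pos_add_two_le (pos_inl_lt_iff.1
        (by omega : pos (.inl b : PathVert d) < pos (.inl a)))
      omega
  rcases u with i | y <;> rcases v with j | z
  · have h1 := (graphG_adj_inl_inr.1 hu.symm).unique (graphG_adj_inl_inr.1 hv.symm)
    exact graphG_adj_inl_inl.1 huv (Fin.ext h1)
  · exact key hu.symm huv hv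
  · exact key hv.symm huv.symm hu
  · have h1 := graphG_adj_inr_inr.1 hu
    have h2 := graphG_adj_inr_inr.1 hv
    have h3 := graphG_adj_inr_inr.1 huv
    omega

theorem diamondFree_graphG (d : ℕ) : DiamondFree (graphG d) := by
  rintro ⟨f⟩
  have hadj : ∀ {i j : Fin 4}, diamond.Adj i j → (graphG d).Adj (f i) (f j) := f.map_adj_iff.2
  have h01 : ¬ diamond.Adj 0 1 := by simp [diamond]
  have h02 : diamond.Adj 0 2 := by simp [diamond]
  have h03 : diamond.Adj 0 3 := by simp [diamond]
  have h12 : diamond.Adj 1 2 := by simp [diamond]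
  have h13 : diamond.Adj 1 3 := by simp [diamond]
  have h23 : diamond.Adj 2 3 := by simp [diamond]
  rcases h0 : f 0 with i | x
  · rcases h1 : f 1 with j | y
    · refine h01 (f.map_adj_iff.1 ?_)
      rw [h0, h1, graphG_adj_inl_inl]
      rintro rfl
      exact absurd (f.injective (h0.trans h1.symm)) (by decide)
    · have e2 := hadj h12
      have e3 := hadj h13
      rw [h1] at e2 e3
      exact not_triangle_inr e2 e3 (hadj h23)
  · have e2 := hadj h02
    have e3 := hadj h03
    rw [h0] at e2 e3
    exact not_triangle_inr e2 e3 (hadj h23)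

/-- A sequence of integers that moves by one in each step and never turns back is arithmetic. -/
theorem exists_forall_eq_add_of_no_turn (m : ℕ) (s : ℕ → ℤ)
    (h1 : ∀ i < m, s (i + 1) = s i + 1 ∨ s i = s (i + 1) + 1)
    (h2 : ∀ i, i + 2 ≤ m → s (i + 2) ≠ s i) :
    (∀ i ≤ m, s i = s 0 + i) ∨ (∀ i ≤ m, s i = s 0 - i) := by
  induction m with
  | zero =>
    refine .inl fun i hi => ?_
    obtain rfl : i = 0 := by omega
    simp
  | succ m ih =>
    have ih := ih (fun i hi => h1 i (by omega)) (fun i hi => h2 i (by omega))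
    have hm := h1 m (by omega)
    rcases m with _ | m
    · rcases hm with hm | hm
      · left
        intro i hi
        interval_cases i
        · simp
        · simpa using hm
      · right
        intro i hi
        interval_cases i
        · simp
        · simp only [zero_add] at hm ⊢; push_cast; omega
    · have hm2 := h2 m (by omega)
      rcases ih with ih | ih
      · left
        intro i hi
        rcases hi.lt_or_eq with hi | rfl
        · exact ih i (by omega)
        · have e1 := ih m (by omega)
          have e2 := ih (m + 1) (by omega)
          push_cast at e2 ⊢
          rw [show m + 1 + 1 = m + 2 from rfl] at hm ⊢
          omega
      · right
        intro i hi
        rcases hi.lt_or_eq with hi | rfl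
        · exact ih i (by omega)
        · have e1 := ih m (by omega)
          have e2 := ih (m + 1) (by omega)
          push_cast at e2 ⊢
          rw [show m + 1 + 1 = m + 2 from rfl] at hm ⊢
          omega

/-- `g 0, …, g (n - 1)` are the vertices of an induced cycle of `G_d` in cyclic order; the further
values of `g` are irrelevant. -/
structure IsHoleSeq {d : ℕ} (n : ℕ) (g : ℕ → GVert d) : Prop where
  inj : ∀ i < n, ∀ j < n, g i = g j → i = j
  adj : ∀ i < n, ∀ j < n, (graphG d).Adj (g i) (g j) ↔
    (j = i + 1 ∨ i = j + 1 ∨ (i = 0 ∧ j + 1 = n) ∨ (j = 0 ∧ i + 1 = n))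

theorem IsHoleSeq.rotate {d n : ℕ} {g : ℕ → GVert d} (h : IsHoleSeq n g) {c : ℕ} (hc : c < n) :
    IsHoleSeq n fun i => g ((i + c) % n) := by
  have hmod : ∀ i < n, (i + c < n ∧ (i + c) % n = i + c) ∨
      (n ≤ i + c ∧ (i + c) % n = i + c - n) := by
    intro i hi
    rcases lt_or_ge (i + c) n with h | h
    · exact .inl ⟨h, Nat.mod_eq_of_lt h⟩
    · exact .inr ⟨h, by rw [Nat.mod_eq_sub_mod h, Nat.mod_eq_of_lt (by omega)]⟩
  refine ⟨fun i hi j hj hij => ?_, fun i hi j hj => ?_⟩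
  · have := h.inj _ (Nat.mod_lt _ (by omega)) _ (Nat.mod_lt _ (by omega)) hij
    rcases hmod i hi with h1 | h1 <;> rcases hmod j hj with h2 | h2 <;> omega
  · rw [h.adj _ (Nat.mod_lt _ (by omega)) _ (Nat.mod_lt _ (by omega))]
    rcases hmod i hi with h1 | h1 <;> rcases hmod j hj with h2 | h2 <;> omega

theorem exists_isHoleSeq {d n : ℕ} (hn : 4 ≤ n)
    (h : (SimpleGraph.cycleGraph n).IsIndContained (graphG d)) :
    ∃ g : ℕ → GVert d, IsHoleSeq n g := by
  obtain ⟨f⟩ := h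
  have hval : ∀ i : ℕ, i < n → i % n = i := fun i hi => Nat.mod_eq_of_lt hi
  refine ⟨fun i => f ⟨i % n, Nat.mod_lt _ (by omega)⟩, fun i hi j hj hij => ?_,
    fun i hi j hj => ?_⟩
  · simpa [hval i hi, hval j hj] using f.injective hij
  · rw [f.map_adj_iff, SimpleGraph.cycleGraph_adj']
    simp only [hval i hi, hval j hj]
    rcases lt_trichotomy i j with hij | rfl | hij
    · rw [Fin.coe_sub_iff_lt.2 (show (⟨i, hi⟩ : Fin n) < ⟨j, hj⟩ from hij),
        Fin.coe_sub_iff_le.2 (show (⟨i, hi⟩ : Fin n) ≤ ⟨j, hj⟩ from hij.le)]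
      simp only
      omega
    · rw [Fin.coe_sub_iff_le.2 le_rfl]
      simp only
      omega
    · rw [Fin.coe_sub_iff_lt.2 (show (⟨j, hj⟩ : Fin n) < ⟨i, hi⟩ from hij),
        Fin.coe_sub_iff_le.2 (show (⟨j, hj⟩ : Fin n) ≤ ⟨i, hi⟩ from hij.le)]
      simp only
      omega

/-- A section of a hole that avoids the centers traverses an interval of `P_d`. -/
theorem IsHoleSeq.path_section {d n a m : ℕ} {g : ℕ → GVert d} (h : IsHoleSeq n g)
    (ham : a + m < n) (hp : ∀ i ≤ m, ∃ x : PathVert d, g (a + i) = .inr x) {x y : PathVert d}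
    (hx : g a = .inr x) (hy : g (a + m) = .inr y) :
    (pos y = pos x + m ∨ pos x = pos y + m) ∧
      ∀ z : PathVert d, (pos x < pos z ∧ pos z < pos y) ∨ (pos y < pos z ∧ pos z < pos x) →
        ∃ i, 0 < i ∧ i < m ∧ g (a + i) = .inr z := by
  have : Nonempty (PathVert d) := ⟨x⟩
  choose! w hw using hp
  have hwx : w 0 = x := by
    have := hw 0 (by omega)
    rw [add_zero, hx] at this
    exact (Sum.inr_injective this).symm
  have hwy : w m = y := by
    have := hw m le_rfl
    rw [hy] at this
    exact (Sum.inr_injective this).symm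
  have hs := exists_forall_eq_add_of_no_turn m (fun i => (pos (w i) : ℤ)) (fun i hi => by
      have := (h.adj (a + i) (by omega) (a + (i + 1)) (by omega)).2 (by omega)
      rw [hw i hi.le, hw (i + 1) hi, graphG_adj_inr_inr] at this
      omega) (fun i hi heq => by
      have h1 : w (i + 2) = w i := pos_injective (by exact_mod_cast heq)
      have := h.inj (a + (i + 2)) (by omega) (a + i) (by omega)
        (by rw [hw (i + 2) hi, hw i (by omega), h1])
      omega)
  simp only [hwx] at hs
  rcases hs with hs | hs
  · have hm := hs m le_rfl
    rw [hwy] at hm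
    refine ⟨.inl (by omega), fun z hz => ⟨pos z - pos x, by omega, by omega, ?_⟩⟩
    rw [hw _ (by omega)]
    congr 1
    have := hs (pos z - pos x) (by omega)
    exact pos_injective (by omega)
  · have hm := hs m le_rfl
    rw [hwy] at hm
    refine ⟨.inr (by omega), fun z hz => ⟨pos x - pos z, by omega, by omega, ?_⟩⟩
    rw [hw _ (by omega)]
    congr 1
    have := hs (pos x - pos z) (by omega)
    exact pos_injective (by omega)

/-- A hole with exactly two centers is odd. -/
theorem IsHoleSeq.false_of_two_centers {d n : ℕ} {g : ℕ → GVert d} (h : IsHoleSeq n g)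
    (hn : 4 ≤ n) (he : Even n) {i j : Fin d} (h0 : g 0 = .inl i) (h1 : g 1 = .inl j) : False := by
  have hp : ∀ t ≤ n - 3, ∃ x : PathVert d, g (2 + t) = .inr x := by
    intro t ht
    rcases hg : g (2 + t) with k | x
    · exfalso
      have hk : ∀ s < 2, ∀ l : Fin d, g s = .inl l → (graphG d).Adj (g s) (g (2 + t)) := by
        intro s hs l hl
        rw [hg, hl, graphG_adj_inl_inl]
        rintro rfl
        have := h.inj s (by omega) (2 + t) (by omega) (hl.trans hg.symm)
        omega
      have e0 := (h.adj _ (by omega) _ (by omega)).1 (hk 0 (by omega) i h0)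
      have e1 := (h.adj _ (by omega) _ (by omega)).1 (hk 1 (by omega) j h1)
      omega
    · exact ⟨x, rfl⟩
  obtain ⟨x, hx⟩ := hp 0 (by omega)
  obtain ⟨y, hy⟩ := hp (n - 3) le_rfl
  obtain ⟨hxy, hz⟩ := h.path_section (by omega) hp hx hy
  have hij : i.1 ≠ j.1 := fun hij => by
    have := h.inj 0 (by omega) 1 (by omega) (by rw [h0, h1, Fin.ext hij])
    omega
  have hlx : HasLevel j.1 x := by
    rw [← graphG_adj_inl_inr, ← h1, ← hx]
    exact (h.adj _ (by omega) _ (by omega)).2 (by omega)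
  have hly : HasLevel i.1 y := by
    rw [← graphG_adj_inl_inr, ← h0, ← hy]
    exact (h.adj _ (by omega) _ (by omega)).2 (by omega)
  have hz' : ∀ z : PathVert d, (pos x < pos z ∧ pos z < pos y) ∨ (pos y < pos z ∧ pos z < pos x) →
      ¬ HasLevel i.1 z ∧ ¬ HasLevel j.1 z := by
    intro z hzz
    obtain ⟨t, ht0, ht, hgt⟩ := hz z hzz
    rw [← graphG_adj_inl_inr, ← graphG_adj_inl_inr, ← h0, ← h1, ← hgt,
      h.adj _ (by omega) _ (by omega), h.adj _ (by omega) _ (by omega)]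
    omega
  obtain ⟨c, hc⟩ := he
  rcases hxy with hxy | hxy
  · have := even_dist_of_ne_level (by omega) hij.symm hlx hly
      fun z hz1 hz2 => (hz' z (.inl ⟨hz1, hz2⟩)).symm
    omega
  · have := even_dist_of_ne_level (by omega) hij hly hlx
      fun z hz1 hz2 => hz' z (.inr ⟨hz1, hz2⟩)
    omega

/-- A hole with exactly one center is odd. -/
theorem IsHoleSeq.false_of_one_center {d n : ℕ} {g : ℕ → GVert d} (h : IsHoleSeq n g)
    (hn : 4 ≤ n) (he : Even n) {i : Fin d} (h0 : g 0 = .inl i)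
    (hp : ∀ t ≤ n - 2, ∃ x : PathVert d, g (1 + t) = .inr x) : False := by
  obtain ⟨x, hx⟩ := hp 0 (by omega)
  obtain ⟨y, hy⟩ := hp (n - 2) le_rfl
  obtain ⟨hxy, hz⟩ := h.path_section (by omega) hp hx hy
  have hlx : HasLevel i.1 x := by
    rw [← graphG_adj_inl_inr, ← h0, ← hx]
    exact (h.adj _ (by omega) _ (by omega)).2 (by omega)
  have hly : HasLevel i.1 y := by
    rw [← graphG_adj_inl_inr, ← h0, ← hy]
    exact (h.adj _ (by omega) _ (by omega)).2 (by omega)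
  have hz' : ∀ z : PathVert d, (pos x < pos z ∧ pos z < pos y) ∨ (pos y < pos z ∧ pos z < pos x) →
      ¬ HasLevel i.1 z := by
    intro z hzz
    obtain ⟨t, ht0, ht, hgt⟩ := hz z hzz
    rw [← graphG_adj_inl_inr, ← h0, ← hgt, h.adj _ (by omega) _ (by omega)]
    omega
  obtain ⟨c, hc⟩ := he
  rcases hxy with hxy | hxy
  · have := odd_dist_of_same_level (by omega) hlx hly fun z hz1 hz2 => hz' z (.inl ⟨hz1, hz2⟩)
    omega
  · have := odd_dist_of_same_level (by omega) hly hlx fun z hz1 hz2 => hz' z (.inr ⟨hz1, hz2⟩)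
    omega

theorem evenHoleFree_graphG (d : ℕ) : EvenHoleFree (graphG d) := by
  intro n hn he hcontained
  obtain ⟨g, hg⟩ := exists_isHoleSeq hn hcontained
  by_cases hc : ∃ c < n, ∃ i, g c = .inl i
  · -- rotate the hole so that it starts with a center
    obtain ⟨c, hc, i, hi⟩ := hc
    obtain ⟨g, hg, h0⟩ : ∃ g : ℕ → GVert d, IsHoleSeq n g ∧ g 0 = .inl i :=
      ⟨_, hg.rotate hc, by simpa [Nat.mod_eq_of_lt hc] using hi⟩
    by_cases hp : ∀ t ≤ n - 2, ∃ x : PathVert d, g (1 + t) = .inr x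
    · exact hg.false_of_one_center hn he h0 hp
    · push Not at hp
      obtain ⟨t, ht, hgt⟩ := hp
      rcases hj : g (1 + t) with j | x
      · have hadj : (graphG d).Adj (g 0) (g (1 + t)) := by
          rw [h0, hj, graphG_adj_inl_inl]
          rintro rfl
          have := hg.inj 0 (by omega) (1 + t) (by omega) (h0.trans hj.symm)
          omega
        rw [hg.adj _ (by omega) _ (by omega)] at hadj
        by_cases ht0 : t = 0
        · subst ht0
          exact hg.false_of_two_centers hn he h0 hj
        · obtain rfl : t = n - 2 := by omega
          -- the second center precedes the first one, so the hole is rotated once more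
          refine (hg.rotate (c := 1 + (n - 2)) (by omega)).false_of_two_centers hn he
            (i := j) (j := i) ?_ ?_
          · simpa [Nat.mod_eq_of_lt (show 1 + (n - 2) < n by omega)] using hj
          · simpa [show 1 + (1 + (n - 2)) = n by omega] using h0
      · exact hgt x hj
  · push Not at hc
    have hp : ∀ t ≤ n - 1, ∃ x : PathVert d, g (0 + t) = .inr x := by
      intro t ht
      rcases hgt : g (0 + t) with j | x
      · exact absurd hgt (hc _ (by omega) j)
      · exact ⟨x, rfl⟩
    obtain ⟨x, hx⟩ := hp 0 (by omega)
    obtain ⟨y, hy⟩ := hp (n - 1) le_rfl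
    obtain ⟨hxy, -⟩ := hg.path_section (by omega) hp hx hy
    have hadj := (hg.adj (0 + 0) (by omega) (0 + (n - 1)) (by omega)).2 (by omega)
    rw [hx, hy, graphG_adj_inr_inr] at hadj
    omega

/-! ### Clique cutsets -/

/-- `u` and `v` lie outside of `X` and are connected in `G ∖ X`. -/
def ReachableAvoiding {V : Type*} (G : SimpleGraph V) (X : Set V) (u v : V) : Prop :=
  ∃ (hu : u ∈ Xᶜ) (hv : v ∈ Xᶜ), (G.induce Xᶜ).Reachable ⟨u, hu⟩ ⟨v, hv⟩

namespace ReachableAvoiding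

variable {V : Type*} {G : SimpleGraph V} {X : Set V} {u v w : V}

theorem refl (hu : u ∉ X) : ReachableAvoiding G X u u := ⟨hu, hu, .rfl⟩

theorem symm (h : ReachableAvoiding G X u v) : ReachableAvoiding G X v u :=
  let ⟨hu, hv, h⟩ := h
  ⟨hv, hu, h.symm⟩

theorem trans (h : ReachableAvoiding G X u v) (h' : ReachableAvoiding G X v w) :
    ReachableAvoiding G X u w :=
  let ⟨hu, _, h⟩ := h
  let ⟨_, hw, h'⟩ := h'
  ⟨hu, hw, h.trans h'⟩

theorem of_adj (hu : u ∉ X) (hv : v ∉ X) (h : G.Adj u v) : ReachableAvoiding G X u v :=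
  ⟨hu, hv, SimpleGraph.Adj.reachable (G := G.induce Xᶜ) (u := ⟨u, hu⟩) (v := ⟨v, hv⟩) h⟩

end ReachableAvoiding

/-- An interval of `P_d` that avoids `X` is connected. -/
theorem reachableAvoiding_of_interval {d : ℕ} {X : Set (GVert d)} {x y : PathVert d}
    (hxy : pos x ≤ pos y)
    (h : ∀ z : PathVert d, pos x ≤ pos z → pos z ≤ pos y → (.inr z : GVert d) ∉ X) :
    ReachableAvoiding (graphG d) X (.inr x) (.inr y) := by
  obtain ⟨n, hn⟩ := Nat.exists_eq_add_of_le hxy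
  induction n generalizing y with
  | zero =>
    rw [pos_injective (show pos y = pos x by omega)]
    exact .refl (h x le_rfl hxy)
  | succ n ih =>
    obtain ⟨z, hz⟩ := exists_pos_eq (x := x) (y := y) (n := pos x + n) (by omega) (by omega)
    refine (ih (y := z) (by omega) (fun w h1 h2 => h w h1 (by omega)) hz).trans ?_
    exact .of_adj (h z (by omega) (by omega)) (h y hxy le_rfl)
      (graphG_adj_inr_inr.2 (.inl (by omega)))

/-- The tuple `p ++ [x]`. -/
def Tuple.mk' {d : ℕ} (p : List ℕ) (x : ℕ) (hl : p.length + 1 ≤ d) (hp : ∀ y ∈ p, y = 1 ∨ y = 3)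
    (h1 : 1 ≤ x) (h4 : x ≤ 4) : Tuple d := ⟨p ++ [x], .mk hl hp h1 h4⟩

/-- The tuple `(x)` of length one. -/
def Tuple.one {d : ℕ} (hd : 2 ≤ d) (x : ℕ) (h1 : 1 ≤ x) (h4 : x ≤ 4) : Tuple d :=
  .mk' [] x (by simp; omega) (by simp) h1 h4

/-- The tuple `(a, x)` of length two. -/
def Tuple.two {d : ℕ} (hd : 2 ≤ d) (a x : ℕ) (ha : a = 1 ∨ a = 3) (h1 : 1 ≤ x) (h4 : x ≤ 4) :
    Tuple d :=
  .mk' [a] x (by simpa using hd) (by simpa using ha) h1 h4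

/-- The path `P_d` starts in `(1)`. -/
theorem pos_first_le {d : ℕ} (hd : 2 ≤ d) (x : PathVert d) :
    pos (.inl (.one hd 1 le_rfl (by norm_num)) : PathVert d) ≤ pos x := by
  have key : ∀ a : Tuple d, Tuple.one hd 1 le_rfl (by norm_num) ≤ a := by
    intro a
    obtain ⟨p, x, hpx, rfl, hl, hp, h1, h4⟩ := a.exists_eq
    refine le_trans (b := p ++ [x]) ?_ le_rfl
    show [1] ≤ p ++ [x]
    cases p with
    | nil => exact not_lt.1 fun h => h1.not_gt ((List.append_singleton_lt_iff (p := [])).1 h)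
    | cons b p =>
      rcases hp b (by simp) with rfl | rfl
      · exact List.cons_le_cons 1 (not_lt.1 (List.not_lt_nil _))
      · exact (List.cons_lt_cons_iff.2 (.inl (by norm_num))).le
  rw [← not_lt, pos_lt_pos_iff]
  intro h
  rcases x with a | ⟨e, m⟩ <;> simp only [pathKey, Prod.Lex.toLex_lt_toLex] at h
  · exact (key a).not_gt (by simpa using h)
  · exact (key e.1.1).not_gt (by simpa using h)

/-- The path `P_d` ends in `(4)`. -/
theorem le_pos_last {d : ℕ} (hd : 2 ≤ d) (x : PathVert d) :
    pos x ≤ pos (.inl (.one hd 4 (by norm_num) le_rfl) : PathVert d) := by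
  have key : ∀ a : Tuple d, a ≤ Tuple.one hd 4 (by norm_num) le_rfl := by
    intro a
    obtain ⟨p, x, hpx, rfl, hl, hp, h1, h4⟩ := a.exists_eq
    refine le_trans (b := p ++ [x]) le_rfl ?_
    show p ++ [x] ≤ [4]
    cases p with
    | nil => exact not_lt.1 fun h => h4.not_gt ((List.append_singleton_lt_iff (p := [])).1 h)
    | cons b p =>
      refine (List.cons_lt_cons_iff.2 (.inl ?_)).le
      rcases hp b (by simp) with rfl | rfl <;> norm_num
  rw [← not_lt, pos_lt_pos_iff]
  intro h
  rcases x with a | ⟨e, m⟩ <;> simp only [pathKey, Prod.Lex.toLex_lt_toLex] at h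
  · exact (key a).not_gt (by simpa using h)
  · rcases h with h | ⟨h, -⟩
    · exact (key e.1.1).not_gt h
    · exact (key e.1.2).not_gt (h ▸ e.2.1)

theorem Tuple.one_lt_two {d : ℕ} (hd : 2 ≤ d) {a b x : ℕ} (h1 : 1 ≤ a) (h4 : a ≤ 4)
    (hb : b = 1 ∨ b = 3) (hx1 : 1 ≤ x) (hx4 : x ≤ 4) (h : a ≤ b) :
    Tuple.one hd a h1 h4 < Tuple.two hd b x hb hx1 hx4 := by
  show [a] < [b, x]
  rw [List.cons_lt_cons_iff]
  rcases h.lt_or_eq with h | rfl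
  · exact .inl h
  · exact .inr ⟨rfl, List.nil_lt_cons _ _⟩

theorem Tuple.two_lt_one {d : ℕ} (hd : 2 ≤ d) {a b x : ℕ} (h1 : 1 ≤ a) (h4 : a ≤ 4)
    (hb : b = 1 ∨ b = 3) (hx1 : 1 ≤ x) (hx4 : x ≤ 4) (h : b < a) :
    Tuple.two hd b x hb hx1 hx4 < Tuple.one hd a h1 h4 := by
  show [b, x] < [a]
  rw [List.cons_lt_cons_iff]
  exact .inl h

theorem exists_hasLevel {d : ℕ} (i : Fin d) : ∃ x : PathVert d, HasLevel i.1 x :=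
  ⟨_, .mk' (List.replicate i.1 1) 1 (by simp) (by simp) le_rfl (by norm_num), rfl, by
    simp [Tuple.mk']⟩

theorem HasLevel.exists_eq_one {d : ℕ} (hd : 2 ≤ d) {x : PathVert d} (h : HasLevel 0 x) :
    ∃ (a : ℕ) (h1 : 1 ≤ a) (h4 : a ≤ 4), x = .inl (.one hd a h1 h4) := by
  obtain ⟨a, rfl, ha⟩ := h
  obtain ⟨p, y, hpy, rfl, hl, hp, h1, h4⟩ := a.exists_eq
  obtain rfl : p = [] := by simpa using ha
  exact ⟨y, h1, h4, rfl⟩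

/-- All vertices outside of a clique are connected to a common vertex, which is the first
center, or the second center, or the first vertex of the path. -/
theorem exists_forall_reachableAvoiding {d : ℕ} (hd : 2 ≤ d) {X : Set (GVert d)}
    (hX : (graphG d).IsClique X) : ∃ r, ∀ v, v ∉ X → ReachableAvoiding (graphG d) X v r := by
  let v₁ : Fin d := ⟨0, by omega⟩
  let v₂ : Fin d := ⟨1, by omega⟩
  -- it suffices to treat vertices of the path if the common vertex is a center
  have hcenter : ∀ k : Fin d, (.inl k : GVert d) ∉ X →
      (∀ x : PathVert d, .inr x ∉ X → ReachableAvoiding (graphG d) X (.inr x) (.inl k)) →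
      ∃ r, ∀ v, v ∉ X → ReachableAvoiding (graphG d) X v r := by
    refine fun k hk h => ⟨.inl k, ?_⟩
    rintro (i | x) hv
    · by_cases hik : i = k
      · exact hik ▸ .refl hv
      · exact .of_adj hv hk (graphG_adj_inl_inl.2 hik)
    · exact h x hv
  by_cases h1 : (.inl v₁ : GVert d) ∈ X
  · by_cases hp : ∃ p : PathVert d, .inr p ∈ X
    · -- `X` consists of the first center and of one vertex `p = (a)` of `P_d`
      obtain ⟨p, hp⟩ := hp
      have hlev : ∀ q : PathVert d, .inr q ∈ X → HasLevel 0 q := fun q hq =>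
        graphG_adj_inl_inr.1 (hX h1 hq (by simp))
      have huniq : ∀ q : PathVert d, .inr q ∈ X → q = p := by
        intro q hq
        by_contra hne
        exact not_triangle_inr (hX hq h1 (by simp)) (hX hq hp (by simpa using hne))
          (hX h1 hp (by simp))
      have h2 : (.inl v₂ : GVert d) ∉ X := by
        intro h2
        have := (graphG_adj_inl_inr.1 (hX h2 hp (by simp))).unique (hlev p hp)
        simp [v₂] at this
      have hspoke : ∀ b x hb hx1 hx4, pos (.inl (Tuple.two hd b x hb hx1 hx4)) ≠ pos p →
          ReachableAvoiding (graphG d) X (.inr (.inl (Tuple.two hd b x hb hx1 hx4))) (.inl v₂) := by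
        intro b x hb hx1 hx4 hne
        refine .of_adj (fun hmem => hne (congrArg pos (huniq _ hmem))) h2 ?_
        exact (graphG_adj_inl_inr.2 ⟨_, rfl, rfl⟩).symm
      obtain ⟨a, ha1, ha4, rfl⟩ := HasLevel.exists_eq_one hd (hlev p hp)
      refine hcenter v₂ h2 fun x hx => ?_
      have hxp : pos x ≠ pos (.inl (Tuple.one hd a ha1 ha4) : PathVert d) :=
        fun h => hx (pos_injective h ▸ hp)
      rcases hxp.lt_or_gt with hlt | hgt
      · -- `(1, 1)` comes before `p`, like `x`, so that the interval between them avoids `X`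
        have ha : 1 < a := by
          rcases ha1.lt_or_eq with h | rfl
          · exact h
          · exact absurd hlt (pos_first_le hd x).not_gt
        have h11 := Tuple.two_lt_one hd ha1 ha4 (.inl rfl) le_rfl (by norm_num : 1 ≤ 4) ha
        have h11 := pos_inl_lt_iff.2 h11
        refine .trans ?_ (hspoke 1 1 (.inl rfl) le_rfl (by norm_num) h11.ne)
        have hfree : ∀ z : PathVert d, pos z < pos (.inl (Tuple.one hd a ha1 ha4) : PathVert d) →
            (.inr z : GVert d) ∉ X := fun z hz hmem => hz.ne (congrArg pos (huniq z hmem))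
        rcases le_total (pos x) (pos (.inl (Tuple.two hd 1 1 (.inl rfl) le_rfl (by norm_num)))) with
          hle | hle
        · exact reachableAvoiding_of_interval hle fun z _ hz => hfree z (by omega)
        · exact (reachableAvoiding_of_interval hle fun z _ hz => hfree z (by omega)).symm
      · -- `(3, 4)` comes after `p`, like `x`
        have ha : a ≤ 3 := by
          rcases ha4.lt_or_eq with h | rfl
          · omega
          · exact absurd hgt (le_pos_last hd x).not_gt
        have h34 := Tuple.one_lt_two hd ha1 ha4 (.inr rfl) (by norm_num) (le_refl 4) ha
        have h34 := pos_inl_lt_iff.2 h34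
        refine .trans ?_ (hspoke 3 4 (.inr rfl) (by norm_num) le_rfl h34.ne')
        have hfree : ∀ z : PathVert d, pos (.inl (Tuple.one hd a ha1 ha4) : PathVert d) < pos z →
            (.inr z : GVert d) ∉ X := fun z hz hmem => hz.ne' (congrArg pos (huniq z hmem))
        rcases le_total (pos x) (pos (.inl (Tuple.two hd 3 4 (.inr rfl) (by norm_num) le_rfl))) with
          hle | hle
        · exact reachableAvoiding_of_interval hle fun z hz _ => hfree z (by omega)
        · exact (reachableAvoiding_of_interval hle fun z hz _ => hfree z (by omega)).symm
    · -- `X` consists of centers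
      push Not at hp
      have hpath : ∀ x : PathVert d, ReachableAvoiding (graphG d) X (.inr x)
          (.inr (.inl (.one hd 1 le_rfl (by norm_num)))) := fun x =>
        (reachableAvoiding_of_interval (pos_first_le hd x) fun z _ _ => hp z).symm
      refine ⟨.inr (.inl (.one hd 1 le_rfl (by norm_num))), ?_⟩
      rintro (i | x) hv
      · obtain ⟨x, hx⟩ := exists_hasLevel i
        exact .trans (.of_adj hv (hp x) (graphG_adj_inl_inr.2 hx)) (hpath x)
      · exact hpath x
  · -- the first center is adjacent to both ends of `P_d`, and `X` cannot separate a vertex of the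
    -- path from both ends
    refine hcenter v₁ h1 fun x hx => ?_
    by_cases hl : ∀ z : PathVert d, pos z ≤ pos x → (.inr z : GVert d) ∉ X
    · refine .trans (reachableAvoiding_of_interval (pos_first_le hd x) fun z _ hz =>
        hl z hz).symm ?_
      exact .of_adj (hl _ (pos_first_le hd x)) h1 (graphG_adj_inl_inr.2 ⟨_, rfl, rfl⟩).symm
    · have hr : ∀ z : PathVert d, pos x ≤ pos z → (.inr z : GVert d) ∉ X := by
        push Not at hl
        obtain ⟨y, hyx, hy⟩ := hl
        intro z hz hmem
        have hyx' : pos y ≠ pos x := fun h => hx (pos_injective h ▸ hy)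
        have hzx' : pos z ≠ pos x := fun h => hx (pos_injective h ▸ hmem)
        have := graphG_adj_inr_inr.1 (hX hy hmem fun h => by
          rw [Sum.inr_injective h] at hyx; omega)
        omega
      refine .trans (reachableAvoiding_of_interval (le_pos_last hd x) fun z hz _ => hr z hz) ?_
      exact .of_adj (hr _ (le_pos_last hd x)) h1 (graphG_adj_inl_inr.2 ⟨_, rfl, rfl⟩).symm

theorem preconnected_induce_compl_of_isClique {d : ℕ} (hd : 2 ≤ d) {X : Set (GVert d)}
    (hX : (graphG d).IsClique X) : ((graphG d).induce Xᶜ).Preconnected := by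
  obtain ⟨r, hr⟩ := exists_forall_reachableAvoiding hd hX
  rintro ⟨u, hu⟩ ⟨v, hv⟩
  exact ((hr u hu).trans (hr v hv).symm).2.2

theorem connected_graphG {d : ℕ} (hd : 2 ≤ d) : (graphG d).Connected := by
  have h := preconnected_induce_compl_of_isClique hd (X := ∅) (by simp)
  have : Nonempty (GVert d) := ⟨.inl ⟨0, by omega⟩⟩
  exact ⟨fun u v => (h ⟨u, by simp⟩ ⟨v, by simp⟩).map (SimpleGraph.Embedding.induce _).toHom⟩

theorem not_isCliqueCutset_graphG {d : ℕ} (hd : 2 ≤ d) :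
    ¬ ∃ X : Set (GVert d), IsCliqueCutset (graphG d) X :=
  fun ⟨_, _, hX, h⟩ => h (preconnected_induce_compl_of_isClique hd hX)

/-- If a graph stays connected after the deletion of any clique, then the only way to
decompose it is not to cut it at all. -/
theorem DecomposesInto.of_preconnected {V : Type*} {G : SimpleGraph V} {P : Set V → Prop}
    (hG : ∀ X, G.IsClique X → (G.induce Xᶜ).Preconnected) {S : Set V} (hS : S = Set.univ)
    (h : DecomposesInto G P S) : P S := by
  cases h with
  | piece h => exact h
  | @cut A B X hA hB hAB hAX hBX hX hadj _ _ =>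
    exfalso
    obtain ⟨a, ha⟩ := hA
    obtain ⟨b, hb⟩ := hB
    have hreach := hG X hX ⟨a, Set.disjoint_left.1 hAX ha⟩ ⟨b, Set.disjoint_left.1 hBX hb⟩
    obtain ⟨w⟩ := hreach
    have key : ∀ {u v : ↥(Xᶜ)}, (G.induce Xᶜ).Walk u v → u.1 ∈ A → v.1 ∈ A := by
      intro u v w
      induction w with
      | nil => exact id
      | @cons u v w huv _ ih =>
        intro hu
        refine ih ?_
        have hv : v.1 ∈ A ∪ X ∪ B := hS ▸ Set.mem_univ _
        rcases hv with (hv | hv) | hv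
        · exact hv
        · exact absurd hv v.2
        · exact absurd huv (hadj _ hu _ hv)
    exact Set.disjoint_left.1 hAB (key w ha) hb

/-! ### Induced matchings across balanced vertex partitions of `G_d` -/

/-- There are vertices `x₁, …, x_m` in `X` and `y₁, …, y_m` outside of `X` such that `x_i` and `y_j`
are adjacent exactly if `i = j`. -/
def CrossMatching {V : Type*} (G : SimpleGraph V) (X : Set V) (m : ℕ) : Prop :=
  ∃ x y : Fin m → V, (∀ i, x i ∈ X) ∧ (∀ i, y i ∉ X) ∧ ∀ i j, G.Adj (x i) (y j) ↔ i = j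

theorem CrossMatching.of_compl {V : Type*} {G : SimpleGraph V} {X : Set V} {m : ℕ}
    (h : CrossMatching G Xᶜ m) : CrossMatching G X m := by
  obtain ⟨x, y, hx, hy, hxy⟩ := h
  exact ⟨y, x, fun i => by simpa using hy i, hx, fun i j => by
    rw [G.adj_comm, hxy, eq_comm]⟩

theorem CrossMatching.of_finset {V ι : Type*} {G : SimpleGraph V} {X : Set V} (s : Finset ι)
    (x y : ι → V) (hx : ∀ i ∈ s, x i ∈ X) (hy : ∀ i ∈ s, y i ∉ X)
    (hxy : ∀ i ∈ s, ∀ j ∈ s, G.Adj (x i) (y j) ↔ i = j) : CrossMatching G X s.card := by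
  let e := s.equivFin.symm
  exact ⟨fun i => x (e i), fun i => y (e i), fun i => hx _ (e i).2, fun i => hy _ (e i).2,
    fun i j => by rw [hxy _ (e i).2 _ (e j).2, ← Subtype.ext_iff, e.apply_eq_iff_eq]⟩

/-- The word over `{1, 3}` that encodes a sequence of bits. -/
def bitWord {j : ℕ} (b : Fin j → Bool) : List ℕ := List.ofFn fun i => if b i then 3 else 1

theorem length_bitWord {j : ℕ} (b : Fin j → Bool) : (bitWord b).length = j := by
  simp [bitWord]

theorem mem_bitWord {j : ℕ} (b : Fin j → Bool) {y : ℕ} (hy : y ∈ bitWord b) : y = 1 ∨ y = 3 := by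
  obtain ⟨i, rfl⟩ := (List.mem_ofFn' _ _).1 hy
  dsimp only
  split_ifs <;> simp

theorem bitWord_injective {j : ℕ} : Function.Injective (bitWord (j := j)) := fun b c h => by
  funext i
  have := congrFun (List.ofFn_injective h) i
  cases hb : b i <;> cases hc : c i <;> simp [hb, hc] at this ⊢

/-- The tuple consisting of a word over `{1, 3}` given by bits and of a last entry. -/
def bitTuple {d j : ℕ} (hj : j < d) (b : Fin j → Bool) (x : ℕ) (h1 : 1 ≤ x) (h4 : x ≤ 4) :
    Tuple d :=
  .mk' (bitWord b) x (by rw [length_bitWord]; exact hj) (fun _ => mem_bitWord b) h1 h4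

/-- The block of `b`: the interval of `P_d` from `(b, 1)` to `(b, 4)`. -/
def block {d j : ℕ} (hj : j < d) (b : Fin j → Bool) : Set (PathVert d) :=
  {x | pos (.inl (bitTuple hj b 1 le_rfl (by norm_num)) : PathVert d) ≤ pos x ∧
    pos x ≤ pos (.inl (bitTuple hj b 4 (by norm_num) le_rfl) : PathVert d)}

/-- The first vertex of a block. -/
def blockRep {d j : ℕ} (hj : j < d) (b : Fin j → Bool) : PathVert d :=
  .inl (bitTuple hj b 1 le_rfl (by norm_num))

theorem blockRep_mem {d j : ℕ} (hj : j < d) (b : Fin j → Bool) : blockRep hj b ∈ block hj b := by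
  refine ⟨le_rfl, pos_inl_le_iff.2 (le_of_lt ?_)⟩
  exact List.append_singleton_lt_iff.2 (by norm_num)

/-- Distinct blocks are separated by at least one vertex. -/
theorem not_adj_of_mem_block {d j : ℕ} {hj : j < d} {b c : Fin j → Bool} {x y : PathVert d}
    (hx : x ∈ block hj b) (hy : y ∈ block hj c) (hbc : b ≠ c) :
    ¬ (graphG d).Adj (.inr x) (.inr y) := by
  have key : ∀ {b c : Fin j → Bool} {x y : PathVert d}, x ∈ block hj b → y ∈ block hj c →
      bitWord b < bitWord c → pos x + 2 ≤ pos y := by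
    intro b c x y hx hy h
    have h1 : bitTuple hj b 4 (by norm_num) le_rfl < bitTuple hj c 1 le_rfl (by norm_num) :=
      List.append_lt_append_of_length_eq [4] [1] (by simp [length_bitWord]) h
    have := pos_add_two_le h1
    have := hx.2
    have := hy.1
    omega
  rw [graphG_adj_inr_inr]
  rcases lt_trichotomy (bitWord b) (bitWord c) with h | h | h
  · have := key hx hy h
    omega
  · exact absurd (bitWord_injective h) hbc
  · have := key hy hx h
    omega

/-- A block contains neighbours of all centers but the first `j` ones. -/
theorem exists_mem_block_hasLevel {d j : ℕ} (hj : j < d) (b : Fin j → Bool) (k : Fin d)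
    (hk : j ≤ k.1) : ∃ x ∈ block hj b, HasLevel k.1 x := by
  have hw : ∀ y ∈ bitWord b ++ List.replicate (k.1 - j) 1, y = 1 ∨ y = 3 := by
    intro y hy
    rw [List.mem_append, List.mem_replicate] at hy
    exact hy.elim (mem_bitWord b) fun h => .inl h.2
  have hlen : (bitWord b ++ List.replicate (k.1 - j) 1).length = k.1 := by
    rw [List.length_append, length_bitWord, List.length_replicate]
    omega
  refine ⟨.inl (.mk' (bitWord b ++ List.replicate (k.1 - j) 1) 1 (by omega) hw le_rfl
    (by norm_num)), ⟨pos_inl_le_iff.2 ?_, pos_inl_le_iff.2 ?_⟩, _, rfl, ?_⟩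
  · show bitWord b ++ [1] ≤ bitWord b ++ List.replicate (k.1 - j) 1 ++ [1]
    rcases Nat.eq_zero_or_pos (k.1 - j) with h | h
    · simp [h]
    · obtain ⟨n, hn⟩ := Nat.exists_eq_succ_of_ne_zero h.ne'
      rw [hn, List.replicate_succ, List.append_assoc, List.cons_append,
        show bitWord b ++ 1 :: (List.replicate n 1 ++ [1]) =
          bitWord b ++ [1] ++ (List.replicate n 1 ++ [1]) by simp]
      exact (List.lt_append_of_ne_nil _ (by simp)).le
  · show bitWord b ++ List.replicate (k.1 - j) 1 ++ [1] ≤ bitWord b ++ [4]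
    rw [List.append_assoc]
    refine ((List.append_lt_append_left_iff _ _ _).2 ?_).le
    cases k.1 - j with
    | zero => exact (List.append_singleton_lt_iff (p := [])).2 (by norm_num)
    | succ n =>
      rw [List.replicate_succ, List.cons_append, List.cons_lt_cons_iff]
      exact .inl (by norm_num)
  · show (_ ++ [1]).length = _
    rw [List.length_append, hlen, List.length_singleton]

/-- A block in `X` is matched with all but the first `j` of the centers outside of `X`. -/
theorem crossMatching_of_block_subset {d j : ℕ} {hj : j < d} {X : Set (GVert d)} {b : Fin j → Bool}
    (hb : ∀ x ∈ block hj b, .inr x ∈ X) (s : Finset (Fin d))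
    (hs : ∀ k ∈ s, j ≤ k.1 ∧ .inl k ∉ X) : CrossMatching (graphG d) X s.card := by
  have : Nonempty (PathVert d) := ⟨blockRep hj b⟩
  have h := fun k (hk : k ∈ s) => exists_mem_block_hasLevel hj b k (hs k hk).1
  choose! x hx hxl using h
  refine .of_finset s (fun k => .inr (x k)) (fun k => .inl k) (fun k hk => hb _ (hx k hk))
    (fun k hk => (hs k hk).2) fun k hk l hl => ?_
  rw [(graphG d).adj_comm, graphG_adj_inl_inr]
  constructor
  · exact fun h => Fin.ext ((hxl k hk).unique h)
  · rintro rfl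
    exact hxl k hk

theorem exists_crossing_edge_of_pos_le {d : ℕ} {X : Set (GVert d)} {x y : PathVert d}
    (hxy : pos x ≤ pos y) (hx : .inr x ∈ X) (hy : .inr y ∉ X) :
    ∃ u v : PathVert d, (pos x ≤ pos u ∧ pos u ≤ pos y) ∧ (pos x ≤ pos v ∧ pos v ≤ pos y) ∧
      .inr u ∈ X ∧ .inr v ∉ X ∧ (graphG d).Adj (.inr u) (.inr v) := by
  obtain ⟨n, hn⟩ := Nat.exists_eq_add_of_le hxy
  induction n generalizing y with
  | zero =>
    rw [pos_injective (show pos y = pos x by omega)] at hy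
    exact absurd hx hy
  | succ n ih =>
    obtain ⟨z, hz⟩ := exists_pos_eq (x := x) (y := y) (n := pos x + n) (by omega) (by omega)
    by_cases hzX : .inr z ∈ X
    · exact ⟨z, y, by omega, by omega, hzX, hy, graphG_adj_inr_inr.2 (.inl (by omega))⟩
    · obtain ⟨u, v, hu, hv, h⟩ := ih (y := z) (by omega) hzX hz
      exact ⟨u, v, by omega, by omega, h⟩

/-- If a block contains a vertex of `X` and a vertex outside of `X`, then it contains an edge
between two such vertices. -/
theorem exists_crossing_edge_of_block {d j : ℕ} {hj : j < d} {b : Fin j → Bool}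
    {X : Set (GVert d)} {x y : PathVert d} (hxb : x ∈ block hj b) (hyb : y ∈ block hj b)
    (hx : .inr x ∈ X) (hy : .inr y ∉ X) :
    ∃ u ∈ block hj b, ∃ v ∈ block hj b, .inr u ∈ X ∧ .inr v ∉ X ∧
      (graphG d).Adj (.inr u) (.inr v) := by
  obtain ⟨hx1, hx2⟩ := hxb
  obtain ⟨hy1, hy2⟩ := hyb
  rcases le_total (pos x) (pos y) with h | h
  · obtain ⟨u, v, hu, hv, h⟩ := exists_crossing_edge_of_pos_le h hx hy
    exact ⟨u, ⟨by omega, by omega⟩, v, ⟨by omega, by omega⟩, h⟩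
  · obtain ⟨u, v, hu, hv, hu', hv', h⟩ :=
      exists_crossing_edge_of_pos_le (X := Xᶜ) h hy (by simpa using hx)
    exact ⟨v, ⟨by omega, by omega⟩, u, ⟨by omega, by omega⟩, by simpa using hv', hu', h.symm⟩

/-- If every block of `s` starts outside of `X` and meets `X`, then choosing a crossing edge in
each of these blocks yields an induced matching. -/
theorem crossMatching_of_mixed_blocks {d j : ℕ} {hj : j < d} {X : Set (GVert d)}
    (s : Finset (Fin j → Bool)) (hs : ∀ b ∈ s, .inr (blockRep hj b) ∉ X)
    (hX : ∀ b, ∃ x ∈ block hj b, .inr x ∈ X) : CrossMatching (graphG d) X s.card := by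
  rcases s.eq_empty_or_nonempty with rfl | ⟨b₀, -⟩
  · exact .of_finset ∅ (fun b => .inr (blockRep hj b)) (fun b => .inr (blockRep hj b))
      (by simp) (by simp) (by simp)
  have : Nonempty (PathVert d) := ⟨blockRep hj b₀⟩
  have h : ∀ b ∈ s, ∃ u ∈ block hj b, ∃ v ∈ block hj b, .inr u ∈ X ∧ .inr v ∉ X ∧
      (graphG d).Adj (.inr u) (.inr v) := by
    intro b hb
    obtain ⟨x, hxb, hx⟩ := hX b
    exact exists_crossing_edge_of_block hxb (blockRep_mem hj b) hx (hs b hb)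
  choose! u hu v hv huX hvX huv using h
  refine .of_finset s (fun b => .inr (u b)) (fun b => .inr (v b)) huX hvX fun b hb c hc => ?_
  constructor
  · intro hadj
    by_contra hbc
    exact not_adj_of_mem_block (hu b hb) (hv c hc) hbc hadj
  · rintro rfl
    exact huv b hb

open Classical in
/-- If both `X` and its complement contain the first vertices of at least a third of the `2 ^ j`
blocks, then there is a large induced matching across `X`. -/
theorem exists_crossMatching_of_balanced {d j : ℕ} (hj : j < d) (X : Set (GVert d))
    (h1 : 2 ^ j ≤ 3 * (Finset.univ.filter fun b : Fin j → Bool => .inr (blockRep hj b) ∈ X).card)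
    (h2 : 2 ^ j ≤ 3 * (Finset.univ.filter fun b : Fin j → Bool => .inr (blockRep hj b) ∉ X).card) :
    ∃ m, (2 ^ j ≤ 3 * m ∨ d - j ≤ 2 * m) ∧ CrossMatching (graphG d) X m := by
  by_cases hY : ∃ b, ∀ x ∈ block hj b, (.inr x : GVert d) ∉ X
  · by_cases hX : ∃ b, ∀ x ∈ block hj b, (.inr x : GVert d) ∈ X
    · obtain ⟨b, hb⟩ := hX
      obtain ⟨c, hc⟩ := hY
      have hcard : (Finset.univ.filter fun k : Fin d => j ≤ k.1 ∧ .inl k ∈ X).card +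
          (Finset.univ.filter fun k : Fin d => j ≤ k.1 ∧ .inl k ∉ X).card = d - j := by
        rw [← Finset.filter_filter, ← Finset.filter_filter, Finset.card_filter_add_card_filter_not]
        have := Fin.card_Ici (⟨j, hj⟩ : Fin d)
        rw [← this]
        congr 1
        ext k
        simp [Fin.le_def]
      rcases le_total (Finset.univ.filter fun k : Fin d => j ≤ k.1 ∧ .inl k ∈ X).card
        (Finset.univ.filter fun k : Fin d => j ≤ k.1 ∧ .inl k ∉ X).card with h | h
      · exact ⟨(Finset.univ.filter fun k : Fin d => j ≤ k.1 ∧ .inl k ∉ X).card, .inr (by omega),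
          crossMatching_of_block_subset hb _ fun k hk => by simpa using hk⟩
      · exact ⟨(Finset.univ.filter fun k : Fin d => j ≤ k.1 ∧ .inl k ∈ X).card, .inr (by omega),
          (crossMatching_of_block_subset (X := Xᶜ) hc _ fun k hk => by simpa using hk).of_compl⟩
    · push Not at hX
      refine ⟨_, .inl h1, (crossMatching_of_mixed_blocks (X := Xᶜ) _ (fun b hb => ?_) hX).of_compl⟩
      simpa using hb
  · push Not at hY
    refine ⟨_, .inl h2, crossMatching_of_mixed_blocks _ (fun b hb => ?_) hY⟩
    simpa using hb

theorem exists_lt_two_pow_and_three_mul_lt {d : ℕ} (hd : 22 ≤ d) : ∃ j, d < 2 ^ j ∧ 3 * j < d := by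
  refine ⟨Nat.log 2 d + 1, Nat.lt_pow_succ_log_self (by norm_num) d, ?_⟩
  have h := Nat.pow_log_le_self 2 (show d ≠ 0 by omega)
  have key : ∀ L : ℕ, 5 ≤ L → 3 * (L + 1) < 2 ^ L := by
    intro L hL
    induction L, hL using Nat.le_induction with
    | base => norm_num
    | succ n hn ih => rw [pow_succ]; omega
  by_cases h5 : 5 ≤ Nat.log 2 d
  · exact (key _ h5).trans_le h
  · omega

/-- There is a set `W` of vertices of `G_d` such that any bipartition of the vertex set that splits
`W` into parts of size at least `|W| / 3` is crossed by an induced matching of more than `d / 3`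
edges. -/
theorem exists_set_forall_balanced_crossMatching {d : ℕ} (hd : 22 ≤ d) :
    ∃ W : Set (GVert d), 2 ≤ W.ncard ∧ ∀ X : Set (GVert d),
      W.ncard ≤ 3 * (W ∩ X).ncard → W.ncard ≤ 3 * (W \ X).ncard →
      ∃ m, d < 3 * m ∧ CrossMatching (graphG d) X m := by
  classical
  obtain ⟨j, hj1, hj2⟩ := exists_lt_two_pow_and_three_mul_lt hd
  have hj : j < d := by omega
  let r : (Fin j → Bool) → GVert d := fun b => .inr (blockRep hj b)
  have hr : Function.Injective r := by
    intro b c h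
    by_contra hbc
    have h' : blockRep hj b = blockRep hj c := Sum.inr_injective h
    have h'' : bitWord b ++ [1] = bitWord c ++ [1] := congrArg Subtype.val (Sum.inl_injective h')
    exact hbc (bitWord_injective (List.append_cancel_right h''))
  have hcard : ∀ p : GVert d → Prop, (Set.range r ∩ {v | p v}).ncard =
      (Finset.univ.filter fun b => p (r b)).card := by
    intro p
    rw [← Set.ncard_coe_finset, ← Set.ncard_image_of_injective _ hr]
    congr 1
    ext v
    simp only [Set.mem_inter_iff, Set.mem_range, Set.mem_ofPred_eq, Finset.coe_filter,
      Finset.mem_univ, true_and, Set.mem_image]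
    constructor
    · rintro ⟨⟨b, rfl⟩, h⟩
      exact ⟨b, h, rfl⟩
    · rintro ⟨b, h, rfl⟩
      exact ⟨⟨b, rfl⟩, h⟩
  have hW : (Set.range r).ncard = 2 ^ j := by
    have := hcard fun _ => True
    simpa using this
  refine ⟨Set.range r, by omega, fun X h1 h2 => ?_⟩
  have e1 : (Set.range r ∩ X).ncard = _ := hcard fun v => v ∈ X
  have e2 : (Set.range r \ X).ncard = _ := hcard fun v => v ∉ X
  rw [hW, e1] at h1
  rw [hW, e2] at h2
  obtain ⟨m, hm, hmatch⟩ := exists_crossMatching_of_balanced hj X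
    (by convert h1) (by convert h2)
  exact ⟨m, by omega, hmatch⟩

/-! ### Balanced edges of cubic trees -/

section Tree

variable {N : Type*} {T : SimpleGraph N}

/-- The nodes of the component of `x` in `T - xy`. -/
def branch (T : SimpleGraph N) (x y : N) : Set N :=
  {z | (T.deleteEdges {s(x, y)}).Reachable x z}

theorem self_mem_branch (x y : N) : x ∈ branch T x y := .rfl

theorem mem_branch_or_mem_branch (hT : T.Connected) (x y z : N) :
    z ∈ branch T x y ∨ z ∈ branch T y x := by
  obtain ⟨w⟩ := hT.preconnected z x
  induction w with
  | nil => exact .inl .rfl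
  | @cons a b c hab _ ih =>
    by_cases he : s(a, b) = s(c, y)
    · rcases Sym2.eq_iff.1 he with ⟨rfl, rfl⟩ | ⟨rfl, rfl⟩
      · exact .inl .rfl
      · exact .inr .rfl
    · have hba : (T.deleteEdges {s(c, y)}).Adj b a := by
        simp only [SimpleGraph.deleteEdges_adj, Set.mem_singleton_iff]
        exact ⟨hab.symm, by rwa [Sym2.eq_swap]⟩
      refine ih.imp (fun h => h.trans hba.reachable) fun h => h.trans ?_
      rw [Sym2.eq_swap]
      exact hba.reachable

theorem not_mem_branch_of_mem_branch (hT : T.IsAcyclic) {x y z : N} (hxy : T.Adj x y)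
    (hx : z ∈ branch T x y) : z ∉ branch T y x := by
  intro hy
  have hy' : (T.deleteEdges {s(x, y)}).Reachable y z := by rwa [Sym2.eq_swap]
  exact (SimpleGraph.isAcyclic_iff_forall_adj_isBridge.1 hT hxy) (hx.trans hy'.symm)

/-- A branch consists of its root and of the branches at the further neighbours of the root. -/
theorem exists_mem_branch_of_mem_branch {x y z : N} (hz : z ∈ branch T x y) (hzx : z ≠ x) :
    ∃ w, T.Adj x w ∧ w ≠ y ∧ z ∈ branch T w x := by
  obtain ⟨p, hp⟩ := SimpleGraph.Reachable.exists_isPath hz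
  cases p with
  | nil => exact absurd rfl hzx
  | @cons _ w _ hxw p =>
    rw [SimpleGraph.Walk.cons_isPath_iff] at hp
    simp only [SimpleGraph.deleteEdges_adj, Set.mem_singleton_iff] at hxw
    refine ⟨w, hxw.1, fun h => hxw.2 (by rw [h]), ?_⟩
    refine ⟨p.transfer _ fun e he => ?_⟩
    have he' := p.edges_subset_edgeSet he
    rw [SimpleGraph.edgeSet_deleteEdges] at he' ⊢
    refine ⟨he'.1, ?_⟩
    rintro rfl
    exact hp.2 (p.snd_mem_support_of_mem_edges he)

theorem branch_ssubset_branch (hT : T.IsAcyclic) {x y w : N} (hxw : T.Adj x w) (hwy : w ≠ y) :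
    branch T w x ⊂ branch T x y := by
  have hx : x ∉ branch T w x := not_mem_branch_of_mem_branch hT hxw (self_mem_branch x w)
  refine ⟨fun z hz => ?_, fun h => hx (h (self_mem_branch x y))⟩
  have hxw' : (T.deleteEdges {s(x, y)}).Adj x w := by
    simp only [SimpleGraph.deleteEdges_adj, Set.mem_singleton_iff]
    exact ⟨hxw, by simp [hwy, hxw.ne']⟩
  refine hxw'.reachable.trans ?_
  have hz' := (SimpleGraph.reachable_iff_reflTransGen _ _).1 hz
  clear hz
  -- a walk in `T - wx` that starts in `w` never visits `x`
  induction hz' with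
  | refl => rfl
  | @tail a b ha hab ih =>
    refine ih.trans (SimpleGraph.Adj.reachable ?_)
    have hbx : b ≠ x := by
      rintro rfl
      exact hx ((SimpleGraph.reachable_iff_reflTransGen _ _).2 (ha.tail hab))
    have hax : a ≠ x := by
      rintro rfl
      exact hx ((SimpleGraph.reachable_iff_reflTransGen _ _).2 ha)
    simp only [SimpleGraph.deleteEdges_adj, Set.mem_singleton_iff] at hab ⊢
    refine ⟨hab.1, fun h => ?_⟩
    rcases Sym2.eq_iff.1 h with ⟨rfl, -⟩ | ⟨-, rfl⟩
    · exact hax rfl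
    · exact hbx rfl

end Tree

/-- Starting from an edge with at least a third of `W` on the side of `x`, walk away from the edge
into a heaviest branch until the weight on the other side is at least a third, too. -/
theorem RankDecomposition.exists_balanced_of_le {V : Type*} [Finite V] (D : RankDecomposition V)
    (W : Set V) (hW : 2 ≤ W.ncard) {x y : D.Node} (hxy : D.tree.Adj x y)
    (h : W.ncard ≤ 3 * (W ∩ D.side x y).ncard) :
    ∃ x y, D.tree.Adj x y ∧ W.ncard ≤ 3 * (W ∩ D.side x y).ncard ∧
      W.ncard ≤ 3 * (W \ D.side x y).ncard := by
  induction hn : (branch D.tree x y).ncard using Nat.strong_induction_on generalizing x y with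
  | _ n ih =>
    by_cases h' : W.ncard ≤ 3 * (W \ D.side x y).ncard
    · exact ⟨x, y, hxy, h, h'⟩
    have hsum := Set.ncard_inter_add_ncard_sdiff_eq_ncard W (D.side x y)
    by_cases hleaf : IsLeaf D.tree x
    · -- the side of a leaf has weight at most one
      exfalso
      obtain ⟨c, hc⟩ := Set.ncard_eq_one.1 hleaf
      have hyc : y = c := by
        have : y ∈ D.tree.neighborSet x := hxy
        rwa [hc] at this
      have hone : (W ∩ D.side x y).ncard ≤ 1 := by
        have hx : ∀ v ∈ D.side x y, (D.toLeaf v).1 = x := by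
          intro v hv
          by_contra hne
          obtain ⟨w, hw, hwy, -⟩ := exists_mem_branch_of_mem_branch (T := D.tree) hv hne
          have : w ∈ D.tree.neighborSet x := hw
          rw [hc] at this
          exact hwy (Eq.trans this hyc.symm)
        refine (Set.ncard_le_one (Set.toFinite _)).2 fun u hu v hv => ?_
        exact D.toLeaf.injective (Subtype.ext ((hx u hu.2).trans (hx v hv.2).symm))
      omega
    · have h3 := D.isCubicTree.2.2 x hleaf
      have h2 : (D.tree.neighborSet x \ {y}).ncard = 2 := by
        rw [Set.ncard_sdiff_singleton_of_mem (show y ∈ D.tree.neighborSet x from hxy), h3]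
      obtain ⟨a, b, -, hab⟩ := Set.ncard_eq_two.1 h2
      have ha : a ∈ D.tree.neighborSet x \ {y} := by simp [hab]
      have hb : b ∈ D.tree.neighborSet x \ {y} := by simp [hab]
      have hcover : W ∩ D.side x y ⊆ (W ∩ D.side a x) ∪ (W ∩ D.side b x) := by
        rintro v ⟨hvW, hv⟩
        have hne : (D.toLeaf v).1 ≠ x := fun hvx => hleaf (hvx ▸ (D.toLeaf v).2)
        obtain ⟨w, hw, hwy, hvw⟩ := exists_mem_branch_of_mem_branch (T := D.tree) hv hne
        have hw' : w ∈ D.tree.neighborSet x \ {y} := ⟨hw, hwy⟩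
        rw [hab] at hw'
        rcases hw' with rfl | rfl
        · exact .inl ⟨hvW, hvw⟩
        · exact .inr ⟨hvW, hvw⟩
      have hle := (Set.ncard_le_ncard hcover (Set.toFinite _)).trans (Set.ncard_union_le _ _)
      have hlt : ∀ c ∈ D.tree.neighborSet x \ {y}, (branch D.tree c x).ncard < n := fun c hc =>
        hn ▸ Set.ncard_lt_ncard (branch_ssubset_branch D.isCubicTree.1.isAcyclic hc.1 hc.2)
          (Set.toFinite _)
      by_cases hac : W.ncard ≤ 3 * (W ∩ D.side a x).ncard
      · exact ih _ (hlt a ha) (SimpleGraph.Adj.symm ha.1) hac rfl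
      · exact ih _ (hlt b hb) (SimpleGraph.Adj.symm hb.1) (by omega) rfl

/-- Every set of at least two vertices is split by some tree edge into parts that contain
at least a third of it. -/
theorem RankDecomposition.exists_balanced {V : Type*} [Finite V] (D : RankDecomposition V)
    (W : Set V) (hW : 2 ≤ W.ncard) : ∃ x y, D.tree.Adj x y ∧
      W.ncard ≤ 3 * (W ∩ D.side x y).ncard ∧ W.ncard ≤ 3 * (W \ D.side x y).ncard := by
  obtain ⟨x⟩ := D.isCubicTree.1.connected.nonempty
  obtain ⟨y, hxy⟩ : (D.tree.neighborSet x).Nonempty := by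
    refine Set.nonempty_of_ncard_ne_zero ?_
    by_cases hleaf : IsLeaf D.tree x
    · rw [hleaf]; norm_num
    · rw [D.isCubicTree.2.2 x hleaf]; norm_num
  have hcover : W ⊆ (W ∩ D.side x y) ∪ (W ∩ D.side y x) := fun v hv =>
    (mem_branch_or_mem_branch D.isCubicTree.1.connected x y (D.toLeaf v).1).imp
      (fun h => ⟨hv, h⟩) (fun h => ⟨hv, h⟩)
  have hle := (Set.ncard_le_ncard hcover (Set.toFinite _)).trans (Set.ncard_union_le _ _)
  by_cases h : W.ncard ≤ 3 * (W ∩ D.side x y).ncard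
  · exact D.exists_balanced_of_le W hW hxy h
  · exact D.exists_balanced_of_le W hW hxy.symm (by omega)

/-! ### Lower bounds on rank-width -/

/-- An induced matching across `X` is an identity submatrix of the matrix of the cut. -/
theorem CrossMatching.le_cutRank {V : Type*} [Fintype V] {G : SimpleGraph V} {X : Set V} {m : ℕ}
    (h : CrossMatching G X m) : m ≤ cutRank G X := by
  classical
  obtain ⟨x, y, hx, hy, hxy⟩ := h
  let M : Matrix ↥X ↥(Xᶜ : Set V) (ZMod 2) := (G.adjMatrix (ZMod 2)).submatrix
    (Subtype.val : ↥X → V) (Subtype.val : ↥(Xᶜ : Set V) → V)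
  have hM : cutRank G X = M.rank := by
    unfold cutRank
    convert rfl
  let P : Matrix (Fin m) ↥X (ZMod 2) := .of fun i a => if a = ⟨x i, hx i⟩ then 1 else 0
  let Q : Matrix ↥(Xᶜ : Set V) (Fin m) (ZMod 2) := .of fun a j => if a = ⟨y j, hy j⟩ then 1 else 0
  have hone : P * M * Q = 1 := by
    ext i j
    simp only [Matrix.mul_apply, P, Q, M, Matrix.one_apply, Matrix.of_apply, mul_ite, mul_one,
      mul_zero, Finset.sum_ite_eq', Finset.mem_univ, if_true, Matrix.submatrix_apply,
      SimpleGraph.adjMatrix_apply]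
    rw [Finset.sum_eq_single ⟨x i, hx i⟩ (fun a _ ha => by simp [ha]) (by simp)]
    simp [hxy]
  calc m = (P * M * Q).rank := by rw [hone, Matrix.rank_one, Fintype.card_fin]
    _ ≤ (P * M).rank := Matrix.rank_mul_le_left _ _
    _ ≤ M.rank := Matrix.rank_mul_le_right _ _
    _ = cutRank G X := hM.symm

/-- The tree with nodes `0, …, 2m - 1` in which the node `i ≥ 1` is joined to `⌊i / 2⌋`. -/
def heapTree (m : ℕ) : SimpleGraph (Fin (2 * m)) where
  Adj i j := i ≠ j ∧ (i.1 / 2 = j.1 ∨ j.1 / 2 = i.1)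
  symm := ⟨fun _ _ h => ⟨h.1.symm, h.2.symm⟩⟩
  loopless := ⟨fun _ h => h.1 rfl⟩

theorem heapTree_adj {m : ℕ} {i j : Fin (2 * m)} :
    (heapTree m).Adj i j ↔ i ≠ j ∧ (i.1 / 2 = j.1 ∨ j.1 / 2 = i.1) := Iff.rfl

theorem heapTree_isTree {m : ℕ} (hm : 1 ≤ m) : (heapTree m).IsTree := by
  let root : Fin (2 * m) := ⟨0, by omega⟩
  let parent : Fin (2 * m) → Fin (2 * m) := fun i => ⟨i.1 / 2, by omega⟩
  have hconn : (heapTree m).Connected := by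
    have hroot : ∀ n (hn : n < 2 * m), (heapTree m).Reachable ⟨n, hn⟩ root := by
      intro n
      induction n using Nat.strong_induction_on with
      | _ n ih =>
        intro hn
        rcases Nat.eq_zero_or_pos n with rfl | h0
        · exact .rfl
        · refine .trans (SimpleGraph.Adj.reachable ?_) (ih (n / 2) (by omega) (by omega))
          rw [heapTree_adj, Ne, Fin.mk.injEq]
          exact ⟨by omega, .inl rfl⟩
    have : Nonempty (Fin (2 * m)) := ⟨root⟩
    exact ⟨fun i j => (hroot i.1 i.2).trans (hroot j.1 j.2).symm⟩
  -- each edge joins a node other than the root to its parent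
  have hsub : (heapTree m).edgeSet ⊆ (fun i => s(i, parent i)) '' {root}ᶜ := by
    intro e
    induction e using Sym2.ind with
    | _ i j =>
      rw [SimpleGraph.mem_edgeSet, heapTree_adj]
      rintro ⟨hne, h | h⟩
      · obtain rfl : parent i = j := Fin.ext h
        refine ⟨i, fun hi => hne ?_, rfl⟩
        rw [Set.mem_singleton_iff.1 hi]
        exact Fin.ext (Nat.zero_div 2).symm
      · obtain rfl : parent j = i := Fin.ext h
        refine ⟨j, fun hj => hne ?_, Sym2.eq_swap⟩
        rw [Set.mem_singleton_iff.1 hj]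
        exact Fin.ext (Nat.zero_div 2)
  have hcard : Nat.card (heapTree m).edgeSet + 1 ≤ Nat.card (Fin (2 * m)) := by
    have h1 := (Set.ncard_le_ncard hsub (Set.toFinite _)).trans
      (Set.ncard_image_le (Set.toFinite _))
    rw [Set.ncard_compl, Set.ncard_singleton] at h1
    rw [Nat.card_coe_set_eq]
    have : Nat.card (Fin (2 * m)) = 2 * m := Nat.card_fin _
    omega
  exact SimpleGraph.isTree_iff_connected_and_card.2
    ⟨hconn, le_antisymm hcard hconn.card_vert_le_card_edgeSet_add_one⟩

theorem ncard_neighborSet_heapTree_of_leaf {m : ℕ} {i : Fin (2 * m)}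
    (hi : i.1 = 0 ∨ m ≤ i.1) : ((heapTree m).neighborSet i).ncard = 1 := by
  rw [Set.ncard_eq_one]
  by_cases h0 : i.1 = 0
  · refine ⟨⟨1, by omega⟩, ?_⟩
    ext j
    simp only [SimpleGraph.mem_neighborSet, heapTree_adj, Set.mem_singleton_iff, Fin.ext_iff, Ne]
    omega
  · refine ⟨⟨i.1 / 2, by omega⟩, ?_⟩
    ext j
    simp only [SimpleGraph.mem_neighborSet, heapTree_adj, Set.mem_singleton_iff, Fin.ext_iff, Ne]
    omega

theorem ncard_neighborSet_heapTree_of_internal {m : ℕ} {i : Fin (2 * m)}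
    (h0 : i.1 ≠ 0) (hi : i.1 < m) : ((heapTree m).neighborSet i).ncard = 3 := by
  rw [Set.ncard_eq_three]
  refine ⟨⟨i.1 / 2, by omega⟩, ⟨2 * i.1, by omega⟩, ⟨2 * i.1 + 1, by omega⟩, ?_, ?_, ?_, ?_⟩
  · simp only [Ne, Fin.ext_iff]; omega
  · simp only [Ne, Fin.ext_iff]; omega
  · simp only [Ne, Fin.ext_iff]; omega
  · ext j
    simp only [SimpleGraph.mem_neighborSet, heapTree_adj, Set.mem_singleton_iff,
      Set.mem_insert_iff, Fin.ext_iff, Ne]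
    omega

theorem isLeaf_heapTree_iff {m : ℕ} {i : Fin (2 * m)} :
    IsLeaf (heapTree m) i ↔ i.1 = 0 ∨ m ≤ i.1 := by
  refine ⟨fun h => ?_, ncard_neighborSet_heapTree_of_leaf⟩
  by_contra hi
  push Not at hi
  rw [IsLeaf, ncard_neighborSet_heapTree_of_internal hi.1 hi.2] at h
  norm_num at h

theorem isCubicTree_heapTree {m : ℕ} (hm : 1 ≤ m) : IsCubicTree (heapTree m) := by
  refine ⟨heapTree_isTree hm, ⟨⟨0, by omega⟩, ⟨1, by omega⟩, by simp⟩, fun i hi => ?_⟩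
  rw [isLeaf_heapTree_iff] at hi
  push Not at hi
  exact ncard_neighborSet_heapTree_of_internal hi.1 hi.2

/-- So the minimum in the definition of rank-width is not taken over the empty set. -/
theorem nonempty_rankDecomposition {V : Type*} [Fintype V] (hV : 2 ≤ Fintype.card V) :
    Nonempty (RankDecomposition V) := by
  obtain ⟨m, hm⟩ : ∃ m, Fintype.card V = m + 1 := ⟨Fintype.card V - 1, by omega⟩
  have hcard : Nat.card V = Nat.card {x // IsLeaf (heapTree m) x} := by
    rw [Nat.card_eq_fintype_card, hm]
    have h1 : {x | IsLeaf (heapTree m) x} =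
        insert (⟨0, by omega⟩ : Fin (2 * m)) (Set.Ici ⟨m, by omega⟩) := by
      ext i
      simp only [Set.mem_ofPred_eq, isLeaf_heapTree_iff, Set.mem_insert_iff, Set.mem_Ici,
        Fin.ext_iff, Fin.le_def]
    have h2 : Nat.card {x // IsLeaf (heapTree m) x} = {x | IsLeaf (heapTree m) x}.ncard := rfl
    rw [h2, h1, Set.ncard_insert_of_notMem (by simp [Fin.le_def]; omega) (Set.toFinite _),
      ← Finset.coe_Ici, Set.ncard_coe_finset, Fin.card_Ici]
    simp only
    omega
  exact ⟨⟨Fin (2 * m), heapTree m, isCubicTree_heapTree (by omega), (Finite.card_eq.1 hcard).some⟩⟩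

theorem le_rankWidth {V : Type*} [Fintype V] {G : SimpleGraph V} {k : ℕ}
    (hV : 2 ≤ Fintype.card V) (h : ∀ D : RankDecomposition V, k ≤ D.width G) :
    k ≤ rankWidth G := by
  rw [rankWidth, if_neg (by omega)]
  obtain ⟨D⟩ := nonempty_rankDecomposition hV
  obtain ⟨D', hD'⟩ := Nat.sInf_mem (s := {k : ℕ | ∃ D : RankDecomposition V, D.width G = k})
    ⟨_, D, rfl⟩
  rw [← hD']
  exact h D'

/-- The `Fintype` instance is found by unification, so that it may be the classical one in the
definition of `RankDecomposition.width`. -/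
theorem le_sup_univ {α : Type*} {_ : Fintype α} (f : α → ℕ) (a : α) :
    f a ≤ (Finset.univ : Finset α).sup f :=
  Finset.le_sup (Finset.mem_univ a)

theorem RankDecomposition.cutRank_side_le_width {V : Type*} [Fintype V] (D : RankDecomposition V)
    (G : SimpleGraph V) {x y : D.Node} (hxy : D.tree.Adj x y) :
    cutRank G (D.side x y) ≤ D.width G := by
  unfold RankDecomposition.width
  exact le_sup_univ (fun e : D.tree.Dart => cutRank G (D.side e.fst e.snd)) ⟨(x, y), hxy⟩

theorem lt_three_mul_rankWidth_graphG {d : ℕ} (hd : 22 ≤ d) : d < 3 * rankWidth (graphG d) := by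
  obtain ⟨W, hW, hbal⟩ := exists_set_forall_balanced_crossMatching hd
  have hV : 2 ≤ Fintype.card (GVert d) := by
    rw [← Nat.card_eq_fintype_card]
    exact hW.trans ((Set.ncard_le_ncard (Set.subset_univ W)).trans_eq (Set.ncard_univ _))
  have : d / 3 + 1 ≤ rankWidth (graphG d) := by
    refine le_rankWidth hV fun D => ?_
    obtain ⟨x, y, hxy, h1, h2⟩ := D.exists_balanced W hW
    obtain ⟨m, hm, hmatch⟩ := hbal _ h1 h2
    have := hmatch.le_cutRank.trans (D.cutRank_side_le_width (graphG d) hxy)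
    omega
  omega

/-! ### Balanced vertex partitions from `k`-expressions -/

theorem CliqueWidthBuild.mem_of_adj {V : Type*} {k : ℕ} {S : Set V} {lab : V → Fin k}
    {H : SimpleGraph V} (h : CliqueWidthBuild k S lab H) {u v : V} (huv : H.Adj u v) :
    u ∈ S ∧ v ∈ S := by
  induction h with
  | vertex v lab => exact absurd huv (by simp)
  | union _ _ _ ih₁ ih₂ =>
    rcases huv with huv | huv
    · exact (ih₁ huv).imp .inl .inl
    · exact (ih₂ huv).imp .inr .inr
  | relabel i j _ ih => exact ih huv
  | join i j _ _ ih =>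
    rcases huv with huv | huv
    · exact ih huv
    · rcases ((SimpleGraph.fromRel_adj _ _ _).1 huv).2 with h | h
      · exact ⟨h.1, h.2.1⟩
      · exact ⟨h.2.1, h.1⟩

/-- In each subexpression of a `k`-expression for `G`, vertices of the same label have the same
neighbours outside.  For the induction, `R` collects the pairs of labels that are joined
later in the construction of `G`. -/
theorem CliqueWidthBuild.exists_balanced {V : Type*} [Finite V] {k : ℕ} {S : Set V}
    {lab : V → Fin k} {H : SimpleGraph V} (h : CliqueWidthBuild k S lab H) (G : SimpleGraph V)
    (R : Fin k → Fin k → Prop)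
    (hin : ∀ u ∈ S, ∀ v ∈ S, G.Adj u v ↔ H.Adj u v ∨ R (lab u) (lab v))
    (hout : ∀ u ∈ S, ∀ v ∈ S, lab u = lab v → ∀ w ∉ S, G.Adj u w ↔ G.Adj v w)
    (W : Set V) (hW : 2 ≤ W.ncard) (hS : W.ncard ≤ 3 * (W ∩ S).ncard) :
    ∃ (S' : Set V) (lab' : V → Fin k), W.ncard ≤ 3 * (W ∩ S').ncard ∧
      W.ncard ≤ 3 * (W \ S').ncard ∧
      ∀ u ∈ S', ∀ v ∈ S', lab' u = lab' v → ∀ w ∉ S', G.Adj u w ↔ G.Adj v w := by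
  induction h generalizing R with
  | vertex v lab =>
    refine ⟨{v}, lab, hS, ?_, hout⟩
    have h1 := Set.ncard_inter_add_ncard_sdiff_eq_ncard W {v}
    have h2 : (W ∩ {v}).ncard ≤ 1 :=
      (Set.ncard_le_ncard Set.inter_subset_right (Set.toFinite _)).trans_eq (Set.ncard_singleton v)
    omega
  | @union S₁ S₂ lab₁ lab₂ H₁ H₂ hdisj h₁ h₂ ih₁ ih₂ =>
    by_cases hbal : W.ncard ≤ 3 * (W \ (S₁ ∪ S₂)).ncard
    · exact ⟨_, _, hS, hbal, hout⟩
    dsimp only at hin hout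
    have hsum := Set.ncard_inter_add_ncard_sdiff_eq_ncard W (S₁ ∪ S₂)
    have hle : (W ∩ (S₁ ∪ S₂)).ncard ≤ (W ∩ S₁).ncard + (W ∩ S₂).ncard := by
      rw [Set.inter_union_distrib_left]
      exact Set.ncard_union_le _ _
    have hS₂ : ∀ v ∈ S₂, v ∉ S₁ := fun v h2 h1 => Set.disjoint_left.1 hdisj h1 h2
    by_cases hheavy : W.ncard ≤ 3 * (W ∩ S₁).ncard
    · refine ih₁ R (fun u hu v hv => ?_) (fun u hu v hv huv w hw => ?_) hheavy
      · rw [hin u (.inl hu) v (.inl hv), SimpleGraph.sup_adj, if_pos hu, if_pos hv,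
          or_iff_left fun h => hS₂ u (h₂.mem_of_adj h).1 hu]
      · by_cases hw2 : w ∈ S₂
        · rw [hin u (.inl hu) w (.inr hw2), hin v (.inl hv) w (.inr hw2), SimpleGraph.sup_adj,
            SimpleGraph.sup_adj, if_pos hu, if_pos hv, huv]
          have hno : ∀ t ∈ S₁, ¬ (H₁.Adj t w ∨ H₂.Adj t w) := by
            rintro t ht (h | h)
            · exact hw (h₁.mem_of_adj h).2
            · exact hS₂ t (h₂.mem_of_adj h).1 ht
          rw [or_iff_right (hno u hu), or_iff_right (hno v hv)]
        · exact hout u (.inl hu) v (.inl hv) (by rw [if_pos hu, if_pos hv, huv]) w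
            fun h => h.elim hw hw2
    · refine ih₂ R (fun u hu v hv => ?_) (fun u hu v hv huv w hw => ?_) (by omega)
      · rw [hin u (.inr hu) v (.inr hv), SimpleGraph.sup_adj, if_neg (hS₂ u hu),
          if_neg (hS₂ v hv), or_iff_right fun h => hS₂ u hu (h₁.mem_of_adj h).1]
      · by_cases hw1 : w ∈ S₁
        · rw [hin u (.inr hu) w (.inl hw1), hin v (.inr hv) w (.inl hw1), SimpleGraph.sup_adj,
            SimpleGraph.sup_adj, if_neg (hS₂ u hu), if_neg (hS₂ v hv), huv]
          have hno : ∀ t ∈ S₂, ¬ (H₁.Adj t w ∨ H₂.Adj t w) := by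
            rintro t ht (h | h)
            · exact hS₂ t ht (h₁.mem_of_adj h).1
            · exact hw (h₂.mem_of_adj h).2
          rw [or_iff_right (hno u hu), or_iff_right (hno v hv)]
        · exact hout u (.inr hu) v (.inr hv) (by rw [if_neg (hS₂ u hu), if_neg (hS₂ v hv), huv]) w
            fun h => h.elim hw1 hw
  | @relabel i j S lab H h ih =>
    refine ih (fun a b => R (if a = i then j else a) (if b = i then j else b)) hin
      (fun u hu v hv huv => hout u hu v hv ?_) hS
    simp only [huv]
  | @join i j S lab H hij h ih =>
    refine ih (fun a b => (a = i ∧ b = j) ∨ (b = i ∧ a = j) ∨ R a b) (fun u hu v hv => ?_) hout hS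
    rw [hin u hu v hv, SimpleGraph.sup_adj, SimpleGraph.fromRel_adj]
    have hne : (lab u = i ∧ lab v = j) ∨ (lab v = i ∧ lab u = j) → u ≠ v := by
      rintro (⟨h1, h2⟩ | ⟨h1, h2⟩) rfl
      · exact hij (h1.symm.trans h2)
      · exact hij (h1.symm.trans h2)
    tauto

/-- The vertices of an induced matching across a set with `k` classes of vertices with the same
neighbours outside belong to different classes. -/
theorem CrossMatching.le_of_labelling {V : Type*} {G : SimpleGraph V} {X : Set V} {m k : ℕ}
    (h : CrossMatching G X m) (lab : V → Fin k)
    (hlab : ∀ u ∈ X, ∀ v ∈ X, lab u = lab v → ∀ w ∉ X, G.Adj u w ↔ G.Adj v w) : m ≤ k := by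
  obtain ⟨x, y, hx, hy, hxy⟩ := h
  have hinj : Function.Injective fun i => lab (x i) := fun i j hij =>
    ((hxy i j).1 ((hlab _ (hx i) _ (hx j) hij _ (hy j)).2 ((hxy j j).2 rfl)))
  simpa using Fintype.card_le_of_injective _ hinj

theorem lt_three_mul_of_cliqueWidthLE_graphG {d k : ℕ} (hd : 22 ≤ d)
    (h : CliqueWidthLE k ((graphG d).induce Set.univ)) : d < 3 * k := by
  obtain ⟨W, hW, hbal⟩ := exists_set_forall_balanced_crossMatching hd
  rcases h with h | ⟨lab, h⟩
  · exact (h.false ⟨.inl ⟨0, by omega⟩, trivial⟩).elim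
  let e : ↥(Set.univ : Set (GVert d)) ≃ GVert d := Equiv.Set.univ _
  have hcard : ∀ A : Set (GVert d), (e ⁻¹' A).ncard = A.ncard := fun A =>
    Set.ncard_preimage_of_injective_subset_range e.injective (by simp [e.range_eq_univ])
  obtain ⟨S, lab', h1, h2, h3⟩ := h.exists_balanced ((graphG d).induce Set.univ)
    (fun _ _ => False) (by simp) (by simp) (e ⁻¹' W) (by rwa [hcard]) (by simp; omega)
  have hS : S = e ⁻¹' (e.symm ⁻¹' S) := by
    ext v
    simp
  rw [hS] at h1 h2
  rw [← Set.preimage_inter, hcard, hcard] at h1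
  rw [← Set.preimage_sdiff, hcard, hcard] at h2
  obtain ⟨m, hm, hmatch⟩ := hbal _ h1 h2
  have := hmatch.le_of_labelling (fun v => lab' (e.symm v)) fun u hu v hv huv w hw =>
    h3 (e.symm u) hu (e.symm v) hv huv (e.symm w) hw
  omega

/-! ### The number of vertices of `G_d` -/

theorem card_tuple_le (d : ℕ) : Fintype.card (Tuple d) ≤ 4 * (2 ^ d - 1) := by
  let f : (Σ k : Fin d, (Fin k → Bool) × Fin 4) → Tuple d := fun t =>
    bitTuple t.1.2 t.2.1 (t.2.2.1 + 1) (by omega) (by omega)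
  have hf : Function.Surjective f := by
    intro a
    obtain ⟨p, x, hpx, rfl, hl, hp, h1, h4⟩ := a.exists_eq
    refine ⟨⟨⟨p.length, hl⟩, fun i => decide (p[i.1] = 3), ⟨x - 1, by omega⟩⟩, Subtype.ext ?_⟩
    have hw : bitWord (fun i : Fin p.length => decide (p[i.1] = 3)) = p := by
      refine List.ext_getElem (by simp [bitWord]) fun i hi hi' => ?_
      simp only [bitWord, List.getElem_ofFn, decide_eq_true_eq]
      rcases hp _ (List.getElem_mem hi') with h | h <;> simp [h]
    show bitWord _ ++ [x - 1 + 1] = p ++ [x]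
    rw [Nat.sub_add_cancel h1]
    exact congrArg (· ++ [x]) hw
  refine (Fintype.card_le_of_surjective f hf).trans_eq ?_
  simp only [Fintype.card_sigma, Fintype.card_prod, Fintype.card_pi, Fintype.card_bool,
    Finset.prod_const, Finset.card_univ, Fintype.card_fin]
  rw [Fin.sum_univ_eq_sum_range (fun k => 2 ^ k * 4) d, ← Finset.sum_mul, mul_comm]
  congr 1
  exact Nat.geomSum_eq (le_refl 2) d |>.trans (by simp)

theorem card_GVert_le (d : ℕ) : Fintype.card (GVert d) ≤ 2 ^ (d + 4) := by
  have hstep : Fintype.card (Step d) ≤ Fintype.card (Tuple d) :=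
    Fintype.card_le_of_injective (fun e => e.1.1) fun _ _ h => Step.ext_left h
  have hsub : Fintype.card (Σ e : Step d, Fin (subdivCount e)) ≤ Fintype.card (Step d) * 2 := by
    rw [Fintype.card_sigma]
    refine (Finset.sum_le_card_nsmul _ _ 2 fun e _ => ?_).trans_eq (by simp)
    rw [Fintype.card_fin]
    unfold subdivCount
    split_ifs <;> norm_num
  have htuple := card_tuple_le d
  have hd : d < 2 ^ d := Nat.lt_two_pow_self
  rw [Fintype.card_sum, Fintype.card_sum, Fintype.card_fin, pow_add]
  omega

theorem logb_card_GVert_le {d : ℕ} (hd : 1 ≤ d) :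
    Real.logb 2 (Fintype.card (GVert d)) - 4 ≤ d := by
  have : Nonempty (GVert d) := ⟨.inl ⟨0, by omega⟩⟩
  have hpos : (0 : ℝ) < Fintype.card (GVert d) := by exact_mod_cast Fintype.card_pos
  have h : Real.logb 2 (Fintype.card (GVert d)) ≤ Real.logb 2 (2 ^ (d + 4)) :=
    Real.logb_le_logb_of_le (by norm_num) hpos (by exact_mod_cast card_GVert_le d)
  rw [Real.logb_pow, Real.logb_self_eq_one (by norm_num)] at h
  push_cast at h
  linarith

theorem mainTheorem1 :
    -- the graphs `G_d`, `d ≥ 2`, are connected, (diamond, even hole)-free, without clique cutset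
    (∀ d : ℕ, 2 ≤ d →
      DiamondFree (graphG d) ∧ EvenHoleFree (graphG d) ∧
      (graphG d).Connected ∧ ¬ ∃ X : Set (GVert d), IsCliqueCutset (graphG d) X) ∧
    -- their rank-width is unbounded
    (¬ ∃ k : ℕ, ∀ d : ℕ, 2 ≤ d → rankWidth (graphG d) ≤ k) ∧
    -- quantitative lower bound
    (∀ d : ℕ, 22 ≤ d →
      (rankWidth (graphG d) : ℝ) > (d : ℝ) / 3 ∧
      (d : ℝ) / 3 ≥ (Real.logb 2 (Fintype.card (GVert d)) - 4) / 3) ∧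
    -- even-hole-free graphs with no clique cutset do not have bounded rank-width
    (¬ ∃ k : ℕ, ∀ (V : Type) [Fintype V] (G : SimpleGraph V),
      G.Connected → EvenHoleFree G → (¬ ∃ X : Set V, IsCliqueCutset G X) →
      rankWidth G ≤ k) ∧
    -- (diamond, even hole)-free graphs cannot be decomposed by clique cutsets into graphs of
    -- bounded clique-width
    (¬ ∃ k : ℕ, ∀ (V : Type) [Fintype V] (G : SimpleGraph V),
      DiamondFree G → EvenHoleFree G →
      DecomposesInto G (fun S => CliqueWidthLE k (G.induce S)) Set.univ) := by
  refine ⟨fun d hd => ⟨diamondFree_graphG d, evenHoleFree_graphG d, connected_graphG hd,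
    not_isCliqueCutset_graphG hd⟩, ?_, fun d hd => ⟨?_, ?_⟩, ?_, ?_⟩
  · rintro ⟨k, hk⟩
    have h1 := hk (3 * k + 22) (by omega)
    have h2 := lt_three_mul_rankWidth_graphG (d := 3 * k + 22) (by omega)
    omega
  · have h : (d : ℝ) < 3 * (rankWidth (graphG d) : ℝ) := by
      exact_mod_cast lt_three_mul_rankWidth_graphG hd
    linarith
  · have := logb_card_GVert_le (d := d) (by omega)
    linarith
  · rintro ⟨k, hk⟩
    have h1 := hk _ (graphG (3 * k + 22)) (connected_graphG (by omega)) (evenHoleFree_graphG _)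
      (not_isCliqueCutset_graphG (by omega))
    have h2 := lt_three_mul_rankWidth_graphG (d := 3 * k + 22) (by omega)
    omega
  · rintro ⟨k, hk⟩
    have h1 := (hk _ (graphG (3 * k + 22)) (diamondFree_graphG _) (evenHoleFree_graphG _))
      |>.of_preconnected (fun X hX => preconnected_induce_compl_of_isClique (by omega) hX) rfl
    have h2 := lt_three_mul_of_cliqueWidthLE_graphG (d := 3 * k + 22) (by omega) h1
    omega
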